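/- **Setting.** Let $n\ge 0$ and $N\ge 0$ be integers and let $e_1,\dots,e_{n+1}$ be the standard basis of $\mathbb C^{n+1}$ with the bilinear form $(e_a,e_b)=\delta_{ab}$. Put $\alpha_k=e_k-e_{k+1}$ $(1\le k\le n)$, $\Lambda_1=e_1-\frac1{n+1}\sum_a e_a$, and $h_k=\Lambda_1-\alpha_1-\dots-\alpha_{k-1}$ $(1\le k\le n+1)$. Let $\lambda\in\mathrm{span}_{\mathbb C}\{\alpha_1,\dots,\alpha_n\}$, let $\kappa\in\mathbb C\setminus\{0\}$, and let $i_1,\dots,i_N\in\{1,\dots,n+1\}$; these numbers encode the chain of channels of $U_q(sl(n+1))$-modules, $q=e^{2\pi i/\kappa}$, $$V_\lambda\to V_{\lambda+h_{i_1}}\to V_{\lambda+h_{i_1}+h_{i_2}}\to\dots\to V_{\lambda+h_{i_1}+\dots+h_{i_N}}.$$ Put $\lambda^{(j)}=\lambda+h_{i_1}+\dots+h_{i_{j-1}}$. Let $0<z_1<\dots<z_N$ be real. **The integral.** For each step $j$ take $i_j-1$ variables $t_{j,1},\dots,t_{j,i_j-1}$, and assign the root $\alpha_p$ to $t_{j,p}$.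 Consider $$I(z,\kappa)=\int \prod_{j,p} t_{j,p}^{-(\lambda,\alpha_p)/\kappa}\ \prod_{k,j}(z_k-t_{j,1})^{-(\Lambda_1,\alpha_1)/\kappa}\ \prod (t_{j,p}-t_{j',p'})^{(\alpha_p,\alpha_{p'})/\kappa}\ \prod_{j,p}\frac{dt_{j,p}}{t_{j,p}},$$ where the third product is over unordered pairs of distinct variables, over the cycle attached to the chain: with $t_{j,0}=z_j$, the variable $t_{j,p}$ runs over the loop $t_{j,p}=t_{j,p-1}e^{i\theta_{j,p}}$, $0\le\theta_{j,p}\le 2\pi$, which starts and ends at $t_{j,p-1}$ and goes once anticlockwise around $0$ and around all points of earlier steps. Here $t_{j,p}^{a}=\exp\big(a(\log z_j+i\theta_{j,1}+\dots+i\theta_{j,p})\big)$; the differential form is $\prod i\,d\theta_{j,p}$; every difference is written as the outer point $x$ minus the inner point $y$, with $(x-y)^a=x^a(1-y/x)^a$ and the principal branch of $(1-y/x)^a$ (points of a later step are outer, and within step $j$ the order from outer to inner is $z_j,t_{j,1},t_{j,2},\dots$). **Claim.** 1. For $\mathrm{Re}(1/\kappa)<1$ the integral converges absolutely. For fixed $z$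 and $\lambda$ it continues analytically in $\kappa$ to all $\kappa\ne0$ with $1/\kappa\notin\{1,2,3,\dots\}$; call the continuation $I(z,\kappa)$ as well. 2. For all these $\kappa$ the leading asymptotic of $I(z,\kappa)$ is $C\,z^\mu=C\prod_j z_j^{\mu_j}$, that is, $I(z,\kappa)/z^\mu\to C$ as $z_i/z_j\to0$ for all $i<j$ (within $0<z_1<\dots<z_N$), where $$\mu_j=\frac{\big(\lambda^{(j)},\sum_{i=1}^{i_j-1}-\alpha_i\big)-(i_j-1)+\big(h_{i_1}+\dots+h_{i_{j-1}}-(j-1)\Lambda_1,\Lambda_1\big)}{\kappa},$$ $$C=\prod_{j=1}^N\prod_{p=1}^{i_j-1}\exp\Big(\pi i\Big(A_{j,p}-\frac{p-1}{\kappa}\Big)\Big)\frac{2\pi i\,\Gamma(1-\frac1\kappa)}{\Gamma\big(A_{j,p}-\frac p\kappa+1\big)\,\Gamma\big(-A_{j,p}+\frac{p-1}\kappa+1\big)},\qquad A_{j,p}=\frac{\big(\lambda^{(j)},\sum_{i=i_j-p}^{i_j-1}-\alpha_i\big)}{\kappa},$$ with the convention $1/\Gamma(-m)=0$ for $m=0,1,2,\dots$.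 3. Let $\lambda,\kappa$ be generic, meaning $\kappa\notin\mathbb Q$ and $(\lambda,e_a-e_b)\notin\mathbb Z+\mathbb Z\kappa$ for all $a\ne b$. Then $1/\kappa\notin\{1,2,3,\dots\}$, $C\ne0$, and for all $i\ne j$ $$\mu_i-\mu_j+\frac{j-i}{\kappa}\notin\mathbb Z .$$ Moreover the exponents are generic for the Harish-Chandra series: with $\rho=\frac1{2\kappa}(N-1,N-3,\dots,1-N)$ and $\eta=\mu-\rho$ one has $\eta_i-\eta_j=\mu_i-\mu_j+\frac{i-j}{\kappa}\notin\mathbb Z$ for all $i\neq j$. -/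

import Mathlib

open Complex MeasureTheory Filter Topology
open scoped Matrix

namespace SelbergBlock

noncomputable section

/-! ### Weights of `sl(n+1)`

Weights are vectors in `ℂ^(n+1)`, paired by the bilinear form `x ⬝ᵥ y = ∑ k, x k * y k`.
Indices start at `0`: `simpleRoot n k` is the root usually called `α_{k+1}`. -/

/-- The simple root `e_k - e_{k+1}`. -/
def simpleRoot (n : ℕ) (k : Fin n) : Fin (n + 1) → ℂ :=
  Pi.single k.castSucc 1 - Pi.single k.succ 1

/-- The first fundamental weight: the projection of the first basis vector to the vectors
with coordinate sum zero. -/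
def Lambda1 (n : ℕ) : Fin (n + 1) → ℂ :=
  Pi.single 0 1 - fun _ => 1 / ((n : ℂ) + 1)

/-- The weight `h = Λ₁ - α_1 - ... - α_k` of the vector representation (usually `h_{k+1}`). -/
def h (n : ℕ) (k : Fin (n + 1)) : Fin (n + 1) → ℂ :=
  Lambda1 n - ∑ m : Fin n with m.val < k.val, simpleRoot n m

variable {n N : ℕ}

/-! ### Chains of channels

A chain `V_λ → V_{λ+h_{i_1}} → ... → V_{λ+h_{i_1}+...+h_{i_N}}` is given by
`c : Fin N → Fin (n+1)`; if `j` is the `0`-based number of a step, then `c j` is `i - 1`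
for the label `i` of that step. -/

/-- The sum of the `h`'s of the steps before step `j`. -/
def shiftBefore (c : Fin N → Fin (n + 1)) (j : Fin N) : Fin (n + 1) → ℂ :=
  ∑ k : Fin N with k < j, h n (c k)

/-- The highest weight of the channel in front of step `j`. -/
def weightBefore (lam : Fin (n + 1) → ℂ) (c : Fin N → Fin (n + 1)) (j : Fin N) :
    Fin (n + 1) → ℂ :=
  lam + shiftBefore c j

/-- The exponents `μ_j`. -/
def mu (lam : Fin (n + 1) → ℂ) (κ : ℂ) (c : Fin N → Fin (n + 1)) (j : Fin N) : ℂ :=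
  ((weightBefore lam c j ⬝ᵥ ∑ m : Fin n with m.val < (c j).val, -simpleRoot n m)
    - ((c j : ℕ) : ℂ)
    + ((shiftBefore c j - ((j : ℕ) : ℂ) • Lambda1 n) ⬝ᵥ Lambda1 n)) / κ

/-- `∑ -α_i` over the last `p` of the simple roots `α_1, ..., α_{i_j - 1}` of step `j`. -/
def negTail (c : Fin N → Fin (n + 1)) (j : Fin N) (p : ℕ) : Fin (n + 1) → ℂ :=
  ∑ m : Fin n with (c j).val ≤ m.val + p ∧ m.val < (c j).val, -simpleRoot n m

/-- The leading coefficient. -/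
def leadingCoeff (lam : Fin (n + 1) → ℂ) (κ : ℂ) (c : Fin N → Fin (n + 1)) : ℂ :=
  ∏ j : Fin N, ∏ p ∈ Finset.Icc 1 (c j : ℕ),
    exp (Real.pi * I *
        ((weightBefore lam c j ⬝ᵥ negTail c j p) / κ - ((p : ℂ) - 1) / κ)) *
      (Gamma (1 - 1 / κ) * (2 * Real.pi * I) /
        (Gamma ((weightBefore lam c j ⬝ᵥ negTail c j p) / κ - (p : ℂ) / κ + 1) *
          Gamma ((weightBefore lam c j ⬝ᵥ (-negTail c j p)) / κ + ((p : ℂ) - 1) / κ + 1)))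

/-! ### The integral -/

/-- The chamber `0 < z_1 < ... < z_N`. -/
def chamber (N : ℕ) : Set (Fin N → ℝ) :=
  {z | (∀ j, 0 < z j) ∧ StrictMono z}

/-- The variables of integration: step `j` brings one variable for each of the simple roots
`α_1, ..., α_{i_j - 1}`. -/
abbrev Var (c : Fin N → Fin (n + 1)) : Type := Σ j : Fin N, Fin (c j : ℕ)

/-- The simple root that belongs to a variable. -/
def color (c : Fin N → Fin (n + 1)) (v : Var c) : Fin n :=
  ⟨(v.2 : ℕ), lt_of_lt_of_le v.2.isLt (Nat.lt_succ_iff.mp (c v.1).isLt)⟩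

/-- `v` lies outside `w`: it belongs to a later step, or it is nearer to `z_j` in the chain
`z_j, t_1, t_2, ...` of the same step. -/
abbrev Outside (c : Fin N → Fin (n + 1)) (v w : Var c) : Prop :=
  w.1 < v.1 ∨ (v.1 = w.1 ∧ (v.2 : ℕ) < (w.2 : ℕ))

/-- The cycle, in logarithmic coordinates. In step `j` the first variable is
`t_1 = z_j e^{iθ_1}`, and the next ones are `t_{p+1} = t_p e^{iθ_{p+1}}`, each angle running
from `0` to `2π`: the contour of `t_1` starts and ends at `z_j`, the contour of `t_{p+1}`
starts and ends at `t_p`, and both go once anticlockwise around `0` and around all that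
belongs to the earlier steps. -/
def logT (z : Fin N → ℝ) (c : Fin N → Fin (n + 1)) (θ : Var c → ℝ) (v : Var c) : ℂ :=
  (Real.log (z v.1) : ℂ) + I * ∑ q : Fin (c v.1 : ℕ) with q ≤ v.2, (θ ⟨v.1, q⟩ : ℂ)

/-- `(x - y)^a` for points `x = e^u`, `y = e^w` with `|y| ≤ |x|`, on the branch
`x^a (1 - y/x)^a` with `x^a = e^{au}` and `|arg (1 - y/x)| ≤ π/2`. -/
def powSub (u w a : ℂ) : ℂ := exp (a * u) * (1 - exp (w - u)) ^ a

/-- The integrand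
`∏ t^{(λ,-α)/κ} ∏ (z - t)^{(Λ₁,-α₁)/κ} ∏ (t - t')^{(α,α')/κ} ∏ dt/t`, pulled back to the
angles; differences are written as outer point minus inner point. Each `dt/t` contributes
a factor `i`. -/
def integrand (lam : Fin (n + 1) → ℂ) (κ : ℂ) (c : Fin N → Fin (n + 1)) (z : Fin N → ℝ)
    (θ : Var c → ℝ) : ℂ :=
  (∏ v : Var c, exp ((lam ⬝ᵥ (-simpleRoot n (color c v))) / κ * logT z c θ v)) *
  (∏ j : Fin N, ∏ v : Var c with (v.2 : ℕ) = 0,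
    if v.1 ≤ j
    then powSub (Real.log (z j)) (logT z c θ v)
      ((Lambda1 n ⬝ᵥ (-simpleRoot n (color c v))) / κ)
    else powSub (logT z c θ v) (Real.log (z j))
      ((Lambda1 n ⬝ᵥ (-simpleRoot n (color c v))) / κ)) *
  (∏ x : Var c × Var c with Outside c x.1 x.2,
    powSub (logT z c θ x.1) (logT z c θ x.2)
      ((simpleRoot n (color c x.1) ⬝ᵥ simpleRoot n (color c x.2)) / κ)) *
  I ^ Fintype.card (Var c)

/-- The parameter domain `[0, 2π]^{number of variables}` of the cycle. -/
def cube (c : Fin N → Fin (n + 1)) : Set (Var c → ℝ) :=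
  Set.univ.pi fun _ => Set.Icc 0 (2 * Real.pi)

/-- The integral over the cycle of the chain, as a Lebesgue integral. -/
def cycleIntegral (lam : Fin (n + 1) → ℂ) (κ : ℂ) (c : Fin N → Fin (n + 1))
    (z : Fin N → ℝ) : ℂ :=
  ∫ θ in cube c, integrand lam κ c z θ

/-- The values of `κ` for which the integral has a meaning: `κ ≠ 0` and
`1/κ ∉ {1, 2, 3, ...}`. -/
def regularLevels : Set ℂ := {κ | κ ≠ 0 ∧ ∀ k : ℕ, 1 / κ ≠ (k : ℂ) + 1}

/-- `F z κ` is the integral over the cycle for all regular `κ`: the Lebesgue integral where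
`Re (1/κ) < 1`, continued analytically in `κ`. -/
structure IsBlockIntegral (lam : Fin (n + 1) → ℂ) (c : Fin N → Fin (n + 1))
    (F : (Fin N → ℝ) → ℂ → ℂ) : Prop where
  analytic : ∀ z ∈ chamber N, AnalyticOnNhd ℂ (F z) regularLevels
  eq_integral : ∀ z ∈ chamber N, ∀ κ : ℂ, κ ≠ 0 → (1 / κ).re < 1 →
    F z κ = cycleIntegral lam κ c z

/-- The regime `z_1 ≪ z_2 ≪ ... ≪ z_N` inside the chamber. -/
def asymptoticRegime (N : ℕ) : Filter (Fin N → ℝ) :=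
  𝓟 (chamber N) ⊓ ⨅ (i : Fin N) (j : Fin N) (_ : i < j), comap (fun z => z i / z j) (𝓝 0)

/-- `z^μ = ∏ z_j^{μ_j}`. -/
def monomial (μ : Fin N → ℂ) (z : Fin N → ℝ) : ℂ := ∏ j, (z j : ℂ) ^ μ j

/-! ### Genericity -/

/-- `λ` and `κ` are generic: `κ` is irrational, and `(λ, e_a - e_b) ∉ ℤ + ℤ κ` for `a ≠ b`. -/
def IsGeneric (lam : Fin (n + 1) → ℂ) (κ : ℂ) : Prop :=
  (∀ q : ℚ, κ ≠ (q : ℂ)) ∧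
    ∀ a b : Fin (n + 1), a ≠ b → ∀ m m' : ℤ, lam a - lam b ≠ (m : ℂ) + (m' : ℂ) * κ

/-- `ρ = (N-1, N-3, ..., 1-N) / (2κ)`. -/
def rho (N : ℕ) (κ : ℂ) (j : Fin N) : ℂ := ((N : ℂ) - 1 - 2 * ((j : ℕ) : ℂ)) / (2 * κ)

end

end SelbergBlock

/-!
The proof computes the integral as an explicit power series in the ratios of the `z_j`.

Put `s = 1/κ`. In the angular coordinates of the cycle, a difference of two neighbouring points of
the chain `z_j, t_1, t_2, ...` of one step contributes, besides a power of its outer point, the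
factor `(1 - e^{iθ})^{-s}` with the angle `θ` of the inner one. Differences of other points of one
step do not occur, and points of different steps `i < j` contribute factors
`(1 - (z_i/z_j) e^{ik·θ})^b` with an integer vector `k` and an exponent `b` that is linear in `s`.
The powers of the outer points multiply to `z^μ` times exponentials of the angles
(`total_exponent`). Hence the integrand is `z^μ` times a `modelIntegrand`: a product over the angles
of one-dimensional loop integrands, times factors that are regular as long as the ratios `z_i/z_j`
are less than `1` (`integrand_eq`). This settles the convergence.

The regular factors are expanded into binomial series, and the integral becomes a power series in
the ratios, whose coefficients are products of one-dimensional integrals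
`∫_0^{2π} e^{iaθ} (1 - e^{iθ})^{-s} dθ` (`integral_modelIntegrand`). Their closed form `loopBeta` in
Gamma functions (`loopIntegral_eq_loopBeta`) is Euler's Beta integral after a deformation of the
contour; it makes sense for all `s` other than `1, 2, 3, ...`. By integration by parts it grows only
polynomially in integral translations of `a`, locally uniformly in `s` (`exists_norm_loopBeta_le`),
so the power series still converges there. Its sum is the analytic continuation
(`differentiableOn_loopSeries`), and it tends to its constant term when the ratios tend to `0`
(`tendsto_loopSeries`). The constant term is a product of values of `loopBeta`, and up to the
factors `i` it is the leading coefficient (`leadingCoeff_eq`). Since the set of regular `κ` is the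
complement of a countable set, it is connected, and any continuation is the one constructed here
(`IsBlockIntegral.eq_blockIntegral`).

For generic parameters, `κ (μ_i - μ_j)` is `λ_a - λ_b` plus an integer, where `a`, `b` are the labels
of the steps. If the labels differ, genericity of `λ` applies; if they agree, only the integer is
left, and it is controlled by counting the steps with that label (`IsGeneric.mu_sub_mu_ne`).
-/

namespace SelbergBlock

/-! ### The one-dimensional loop integral -/

/-- The closed form of the loop integral `∫_0^{2π} e^{iaθ} (1 - e^{iθ})^{-s} dθ`. It is entire
in `a`; as a function of `s` it continues the integral to all `s ∉ {1, 2, 3, ...}`. At the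
poles of a Gamma function in the denominator Mathlib's value `Gamma (-m) = 0` gives the
correct value `0`. -/
noncomputable def loopBeta (a s : ℂ) : ℂ :=
  exp (Real.pi * I * a) *
    (2 * Real.pi * Gamma (1 - s) * (Gamma (a - s + 1))⁻¹ * (Gamma (1 - a))⁻¹)

/-- The integrand of the loop integral. -/
noncomputable def loopIntegrand (a s : ℂ) (θ : ℝ) : ℂ :=
  exp (I * a * θ) * (1 - exp (I * θ)) ^ (-s)

lemma one_sub_exp_re_nonneg {ζ : ℂ} (h : ζ.re ≤ 0) : 0 ≤ (1 - exp ζ).re := by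
  have h1 : (exp ζ).re ≤ ‖exp ζ‖ := re_le_norm _
  have h2 : ‖exp ζ‖ ≤ 1 := by rw [norm_exp]; exact Real.exp_le_one_iff.mpr h
  simp only [sub_re, one_re]; linarith

lemma norm_one_sub_exp_le {ζ : ℂ} (h : ζ.re ≤ 0) : ‖1 - exp ζ‖ ≤ 2 := by
  have h2 : ‖exp ζ‖ ≤ 1 := by rw [norm_exp]; exact Real.exp_le_one_iff.mpr h
  calc ‖1 - exp ζ‖ ≤ ‖(1 : ℂ)‖ + ‖exp ζ‖ := norm_sub_le _ _
    _ ≤ 2 := by rw [norm_one]; linarith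

lemma norm_cpow_le_mul_exp (x b : ℂ) : ‖x ^ b‖ ≤ ‖x‖ ^ b.re * Real.exp (Real.pi * |b.im|) := by
  refine (norm_cpow_le x b).trans ?_
  rw [div_eq_mul_inv, ← Real.exp_neg]
  gcongr
  calc -(arg x * b.im) ≤ |arg x * b.im| := neg_le_abs _
    _ = |arg x| * |b.im| := abs_mul _ _
    _ ≤ Real.pi * |b.im| := by gcongr; exact abs_arg_le_pi x

lemma norm_cpow_neg_le_of_re_nonpos {ζ s : ℂ} (h : ζ.re ≤ 0) (hs : s.re ≤ 0) :
    ‖(1 - exp ζ) ^ (-s)‖ ≤ 2 ^ (-s.re) * Real.exp (Real.pi * |s.im|) := by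
  refine (norm_cpow_le_mul_exp _ _).trans ?_
  simp only [neg_re, neg_im, abs_neg]
  have h1 := Real.rpow_le_rpow (norm_nonneg _) (norm_one_sub_exp_le h) (z := -s.re) (by linarith)
  gcongr

lemma norm_exp_I_mul_le (a : ℂ) {θ : ℝ} (h0 : 0 ≤ θ) (h1 : θ ≤ 2 * Real.pi) :
    ‖exp (I * a * θ)‖ ≤ Real.exp (2 * Real.pi * |a.im|) := by
  rw [norm_exp]
  gcongr
  have h2 : (I * a * θ).re = -a.im * θ := by simp
  rw [h2]
  calc -a.im * θ ≤ |a.im| * θ := by gcongr; exact neg_le_abs _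
    _ ≤ |a.im| * (2 * Real.pi) := by gcongr
    _ = _ := by ring

lemma re_I_mul_ofReal (θ : ℝ) : (I * (θ : ℂ)).re = 0 := by simp

lemma measurable_loopIntegrand (a s : ℂ) : Measurable (loopIntegrand a s) := by
  unfold loopIntegrand
  have h : Measurable fun θ : ℝ => (1 - exp (I * (θ : ℂ))) := by fun_prop
  exact (by fun_prop : Measurable fun θ : ℝ => exp (I * a * (θ : ℂ))).mul (h.pow_const _)

/-- The distance of `e^{iθ}` to `1` is at least a multiple of the distance of `θ` to the nearer
end point of `[0, 2π]`. -/
lemma le_norm_one_sub_exp {θ : ℝ} (h0 : 0 < θ) (h1 : θ < 2 * Real.pi) :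
    2 / Real.pi * min θ (2 * Real.pi - θ) ≤ ‖1 - exp (I * (θ : ℂ))‖ := by
  rw [norm_sub_rev, norm_exp_I_mul_ofReal_sub_one]
  refine le_trans ?_ (Real.le_norm_self _)
  rcases le_total θ Real.pi with h | h
  · have := Real.mul_le_sin (x := θ / 2) (by linarith) (by linarith)
    calc 2 / Real.pi * min θ (2 * Real.pi - θ) ≤ 2 / Real.pi * θ := by
          gcongr; exact min_le_left _ _
      _ = 2 * (2 / Real.pi * (θ / 2)) := by ring
      _ ≤ _ := by linarith
  · have := Real.mul_le_sin (x := Real.pi - θ / 2) (by linarith) (by linarith)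
    rw [Real.sin_pi_sub] at this
    calc 2 / Real.pi * min θ (2 * Real.pi - θ) ≤ 2 / Real.pi * (2 * Real.pi - θ) := by
          gcongr; exact min_le_right _ _
      _ = 2 * (2 / Real.pi * (Real.pi - θ / 2)) := by ring
      _ ≤ _ := by linarith

lemma norm_one_sub_exp_rpow_le {θ σ : ℝ} (h0 : 0 < θ) (h1 : θ < 2 * Real.pi) :
    ‖1 - exp (I * (θ : ℂ))‖ ^ (-σ) ≤
      (2 ^ (-σ) + (2 / Real.pi) ^ (-σ)) * (θ ^ (-σ) + (2 * Real.pi - θ) ^ (-σ) + 1) := by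
  have hp := Real.pi_pos
  have p1 : 0 < (2 : ℝ) ^ (-σ) := by positivity
  have p2 : 0 < (2 / Real.pi : ℝ) ^ (-σ) := by positivity
  have p3 : 0 < θ ^ (-σ) := by positivity
  have p4 : 0 < (2 * Real.pi - θ) ^ (-σ) := Real.rpow_pos_of_pos (by linarith) _
  rcases le_total σ 0 with h | h
  · calc ‖1 - exp (I * (θ : ℂ))‖ ^ (-σ) ≤ 2 ^ (-σ) := by
          exact Real.rpow_le_rpow (norm_nonneg _)
            (norm_one_sub_exp_le (re_I_mul_ofReal θ).le) (by linarith)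
      _ ≤ _ := by nlinarith [mul_pos p1 p3, mul_pos p1 p4, mul_pos p2 p3, mul_pos p2 p4]
  · have hm : 0 < min θ (2 * Real.pi - θ) := lt_min h0 (by linarith)
    have hmin : (min θ (2 * Real.pi - θ)) ^ (-σ) ≤ θ ^ (-σ) + (2 * Real.pi - θ) ^ (-σ) := by
      rcases min_choice θ (2 * Real.pi - θ) with h' | h' <;> rw [h'] <;> linarith
    calc ‖1 - exp (I * (θ : ℂ))‖ ^ (-σ) ≤ (2 / Real.pi * min θ (2 * Real.pi - θ)) ^ (-σ) :=
          Real.rpow_le_rpow_of_nonpos (by positivity) (le_norm_one_sub_exp h0 h1) (by linarith)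
      _ = (2 / Real.pi) ^ (-σ) * (min θ (2 * Real.pi - θ)) ^ (-σ) :=
          Real.mul_rpow (by positivity) hm.le
      _ ≤ (2 / Real.pi) ^ (-σ) * (θ ^ (-σ) + (2 * Real.pi - θ) ^ (-σ)) := by gcongr
      _ ≤ _ := by nlinarith [mul_pos p1 p3, mul_pos p1 p4]

/-- An integrable bound for the loop integrands with a given `s`. -/
noncomputable def loopBound (s : ℂ) (θ : ℝ) : ℝ :=
  Real.exp (Real.pi * |s.im|) * ((2 ^ (-s.re) + (2 / Real.pi) ^ (-s.re)) *
    (θ ^ (-s.re) + (2 * Real.pi - θ) ^ (-s.re) + 1))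

lemma intervalIntegrable_loopBound {s : ℂ} (hs : s.re < 1) :
    IntervalIntegrable (loopBound s) volume 0 (2 * Real.pi) := by
  have h1 : IntervalIntegrable (fun θ : ℝ => θ ^ (-s.re)) volume 0 (2 * Real.pi) :=
    intervalIntegral.intervalIntegrable_rpow' (by linarith)
  have h2 : IntervalIntegrable (fun θ : ℝ => (2 * Real.pi - θ) ^ (-s.re)) volume 0
      (2 * Real.pi) := by
    have := (h1.comp_sub_left (2 * Real.pi)).symm
    simpa using this
  exact (((h1.add h2).add intervalIntegrable_const).const_mul _).const_mul _

lemma norm_loopIntegrand_le {a s : ℂ} {θ : ℝ} (h0 : 0 < θ) (h1 : θ < 2 * Real.pi) :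
    ‖loopIntegrand a s θ‖ ≤ Real.exp (2 * Real.pi * |a.im|) * loopBound s θ := by
  unfold loopIntegrand loopBound
  rw [norm_mul]
  gcongr
  · exact norm_exp_I_mul_le a h0.le h1.le
  · refine (norm_cpow_le_mul_exp _ _).trans ?_
    rw [mul_comm]
    simp only [neg_re, neg_im, abs_neg]
    gcongr
    exact norm_one_sub_exp_rpow_le h0 h1

lemma ae_loop_interval : ∀ᵐ θ : ℝ ∂(volume.restrict (Set.uIoc 0 (2 * Real.pi))),
    0 < θ ∧ θ < 2 * Real.pi := by
  rw [Set.uIoc_of_le (by positivity), ← restrict_Ioo_eq_restrict_Ioc]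
  exact ae_restrict_mem measurableSet_Ioo

lemma intervalIntegrable_loopIntegrand (a : ℂ) {s : ℂ} (hs : s.re < 1) :
    IntervalIntegrable (loopIntegrand a s) volume 0 (2 * Real.pi) := by
  refine ((intervalIntegrable_loopBound hs).const_mul (Real.exp (2 * Real.pi * |a.im|))).mono_fun
    (measurable_loopIntegrand a s).aestronglyMeasurable ?_
  filter_upwards [ae_loop_interval] with θ hθ
  exact (norm_loopIntegrand_le hθ.1 hθ.2).trans (Real.le_norm_self _)

/-- The loop integral. -/
noncomputable def loopIntegral (a s : ℂ) : ℂ := ∫ θ in (0 : ℝ)..(2 * Real.pi), loopIntegrand a s θ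

lemma continuous_loopIntegral {s : ℂ} (hs : s.re < 1) : Continuous fun a => loopIntegral a s := by
  rw [continuous_iff_continuousAt]
  intro a₀
  refine intervalIntegral.continuousAt_of_dominated_interval
    (bound := fun θ => Real.exp (2 * Real.pi * (‖a₀‖ + 1)) * loopBound s θ) ?_ ?_ ?_ ?_
  · exact Eventually.of_forall fun a => (measurable_loopIntegrand a s).aestronglyMeasurable
  · have h1 : ∀ᶠ a : ℂ in 𝓝 a₀, ‖a‖ < ‖a₀‖ + 1 :=
      continuous_norm.continuousAt.eventually (gt_mem_nhds (by linarith))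
    filter_upwards [h1] with a ha
    have := (ae_restrict_iff' measurableSet_uIoc).mp ae_loop_interval
    filter_upwards [this] with θ hθ hmem
    have hθ := hθ hmem
    refine (norm_loopIntegrand_le hθ.1 hθ.2).trans ?_
    have : 0 ≤ loopBound s θ := by
      unfold loopBound
      have : 0 ≤ 2 * Real.pi - θ := by linarith
      have := hθ.1
      positivity
    have := (abs_im_le_norm a).trans ha.le
    gcongr
  · exact (intervalIntegrable_loopBound hs).const_mul _
  · refine Eventually.of_forall fun θ _ => ?_
    unfold loopIntegrand
    fun_prop

lemma continuous_one_sub_exp_cpow {b : ℂ} (hb : 0 < b.re) {ζ : ℂ} (hζ : ζ.re ≤ 0) :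
    ContinuousAt (fun ζ : ℂ => (1 - exp ζ) ^ b) ζ :=
  (continuousAt_cpow_const_of_re_pos (Or.inl (one_sub_exp_re_nonneg hζ)) hb).comp
    (f := fun ζ : ℂ => 1 - exp ζ) (by fun_prop)

lemma one_sub_exp_mem_slitPlane {ζ : ℂ} (h : exp ζ ≠ 1) (hζ : ζ.re ≤ 0) :
    1 - exp ζ ∈ slitPlane := by
  rw [mem_slitPlane_iff]
  by_contra hc
  push Not at hc
  have h1 := one_sub_exp_re_nonneg hζ
  exact h (sub_eq_zero.mp (Complex.ext (le_antisymm hc.1 h1) hc.2)).symm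

lemma exp_I_mul_ne_one {θ : ℝ} (h0 : 0 < θ) (h1 : θ < 2 * Real.pi) : exp (I * (θ : ℂ)) ≠ 1 := by
  intro h
  have := le_norm_one_sub_exp h0 h1
  rw [h, sub_self, norm_zero] at this
  have h2 : 0 < 2 / Real.pi * min θ (2 * Real.pi - θ) :=
    mul_pos (by positivity) (lt_min h0 (by linarith))
  linarith

lemma exp_I_mul_two_pi : exp (I * ((2 * Real.pi : ℝ) : ℂ)) = 1 := by
  rw [mul_comm]; push_cast; exact exp_two_pi_mul_I

/-- Integration by parts; the boundary terms vanish since `Re (1 - s) > 0`. -/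
lemma loopIntegral_shift (a : ℂ) {s : ℂ} (hs : s.re < 1) :
    (1 - s) * loopIntegral a s = (a - 1) * loopIntegral (a - 1) (s - 1) := by
  have hs1 : (s - 1).re < 1 := by simp; linarith
  have hs2 : 1 - s ≠ 0 := by
    intro h; have := congrArg re h; simp at this; linarith
  have key : ∫ θ in (0 : ℝ)..(2 * Real.pi),
      ((I * (a - 1)) * loopIntegrand (a - 1) (s - 1) θ - (I * (1 - s)) * loopIntegrand a s θ) =
      loopIntegrand (a - 1) (s - 1) (2 * Real.pi) - loopIntegrand (a - 1) (s - 1) 0 := by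
    refine intervalIntegral.integral_eq_sub_of_hasDerivAt_of_le (by positivity) ?_ ?_ ?_
    · intro θ _
      have h1 : ContinuousAt (fun θ : ℝ => (1 - exp (I * (θ : ℂ))) ^ (-(s - 1))) θ :=
        (continuous_one_sub_exp_cpow (by simp; linarith) (re_I_mul_ofReal θ).le).comp
          (f := fun θ : ℝ => I * (θ : ℂ)) (by fun_prop)
      have h2 : ContinuousAt (fun θ : ℝ => exp (I * (a - 1) * (θ : ℂ))) θ := by fun_prop
      exact (h2.mul h1).continuousWithinAt
    · intro θ hθ
      have hsl := one_sub_exp_mem_slitPlane (exp_I_mul_ne_one hθ.1 hθ.2) (re_I_mul_ofReal θ).le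
      have d0 : HasDerivAt (fun ζ : ℂ => ζ) 1 (θ : ℂ) := hasDerivAt_id _
      have d1 : HasDerivAt (fun ζ : ℂ => exp (I * (a - 1) * ζ))
          (exp (I * (a - 1) * θ) * (I * (a - 1) * 1)) (θ : ℂ) := (d0.const_mul _).cexp
      have d2 : HasDerivAt (fun ζ : ℂ => 1 - exp (I * ζ))
          (-(exp (I * θ) * (I * 1))) (θ : ℂ) := (d0.const_mul _).cexp.const_sub _
      have d3 := d2.cpow_const (c := -(s - 1)) hsl
      refine HasDerivAt.congr_deriv (f := loopIntegrand (a - 1) (s - 1)) (d1.mul d3).comp_ofReal ?_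
      unfold loopIntegrand
      have e1 : exp (I * a * θ) = exp (I * (a - 1) * θ) * exp (I * θ) := by
        rw [← exp_add]; ring_nf
      rw [e1, show -(s - 1) - 1 = -s by ring]
      ring
    · exact ((intervalIntegrable_loopIntegrand _ hs1).const_mul _).sub
        ((intervalIntegrable_loopIntegrand _ hs).const_mul _)
  rw [intervalIntegral.integral_sub ((intervalIntegrable_loopIntegrand _ hs1).const_mul _)
    ((intervalIntegrable_loopIntegrand _ hs).const_mul _), intervalIntegral.integral_const_mul,
    intervalIntegral.integral_const_mul] at key
  have e0 : loopIntegrand (a - 1) (s - 1) 0 = 0 := by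
    simp [loopIntegrand, hs2]
  have e1 : loopIntegrand (a - 1) (s - 1) (2 * Real.pi) = 0 := by
    unfold loopIntegrand
    rw [exp_I_mul_two_pi]; simp [hs2]
  rw [e0, e1, sub_zero] at key
  change I * (a - 1) * loopIntegral (a - 1) (s - 1) - I * (1 - s) * loopIntegral a s = 0 at key
  refine mul_left_cancel₀ I_ne_zero ?_
  linear_combination -key

lemma loopIntegral_sub_one (a : ℂ) {s : ℂ} (hs : s.re < 1) :
    loopIntegral a (s - 1) = loopIntegral a s - loopIntegral (a + 1) s := by
  unfold loopIntegral
  rw [← intervalIntegral.integral_sub (intervalIntegrable_loopIntegrand _ hs)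
    (intervalIntegrable_loopIntegrand _ hs)]
  refine intervalIntegral.integral_congr_ae' ?_ ?_
  · have h := (ae_restrict_iff' measurableSet_uIoc).mp ae_loop_interval
    rw [Set.uIoc_of_le (by positivity)] at h
    filter_upwards [h] with θ hθ hmem
    have hθ := hθ hmem
    have hne : 1 - exp (I * (θ : ℂ)) ≠ 0 := sub_ne_zero.mpr (exp_I_mul_ne_one hθ.1 hθ.2).symm
    unfold loopIntegrand
    have e1 : exp (I * (a + 1) * θ) = exp (I * a * θ) * exp (I * θ) := by
      rw [← exp_add]; ring_nf
    rw [e1, show -(s - 1) = -s + 1 by ring, cpow_add _ _ hne, cpow_one]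
    ring
  · rw [Set.Ioc_eq_empty (by have := Real.pi_pos; simp; linarith)]
    simp

/-- Cauchy's theorem on the rectangle `[-R, 0] × [0, 2π]` in the coordinate `ζ = log x`: the loop
is deformed to the two sides of the segment `[e^{-R}, 1]` and a small circle. -/
lemma loopIntegral_eq_segment_add_circle (a : ℂ) {s : ℂ} (hs : s.re < 0) {R : ℝ} (hR : 0 ≤ R) :
    I * loopIntegral a s =
      (exp (2 * Real.pi * I * a) - 1) *
        (∫ x in (-R)..0, exp (a * x) * (1 - exp (x : ℂ)) ^ (-s)) +
      I * ∫ y in (0 : ℝ)..(2 * Real.pi),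
        exp (a * (((-R : ℝ) : ℂ) + y * I)) * (1 - exp (((-R : ℝ) : ℂ) + y * I)) ^ (-s) := by
  have hp := Real.pi_pos
  have hb : 0 < (-s).re := by simpa using hs
  have key := integral_boundary_rect_eq_zero_of_continuousOn_of_differentiableOn
    (fun ζ => exp (a * ζ) * (1 - exp ζ) ^ (-s)) ⟨-R, 0⟩ ⟨0, 2 * Real.pi⟩ ?_ ?_
  · simp only [smul_eq_mul] at key
    have e1 : ∀ x : ℝ, exp (a * ((x : ℂ) + ((2 * Real.pi : ℝ) : ℂ) * I)) *
        (1 - exp ((x : ℂ) + ((2 * Real.pi : ℝ) : ℂ) * I)) ^ (-s) =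
        exp (2 * Real.pi * I * a) * (exp (a * x) * (1 - exp (x : ℂ)) ^ (-s)) := by
      intro x
      have h1 : exp ((x : ℂ) + ((2 * Real.pi : ℝ) : ℂ) * I) = exp x := by
        push_cast; exact exp_periodic x
      rw [h1, mul_add, exp_add]
      push_cast
      ring_nf
    simp only [e1, intervalIntegral.integral_const_mul] at key
    simp only [ofReal_zero, zero_mul, add_zero, zero_add] at key
    have e2 : loopIntegral a s = ∫ y in (0 : ℝ)..(2 * Real.pi),
        exp (a * (y * I)) * (1 - exp (y * I)) ^ (-s) := by
      unfold loopIntegral loopIntegrand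
      congr 1; ext y; congr 2 <;> ring_nf
    rw [e2]
    linear_combination key
  · intro ζ hζ
    have hre : ζ.re ≤ 0 := by
      have := hζ.1
      simp only [Set.mem_preimage, Set.uIcc_of_le (show -R ≤ 0 by linarith), Set.mem_Icc] at this
      exact this.2
    exact (ContinuousAt.mul (by fun_prop) (continuous_one_sub_exp_cpow hb hre)).continuousWithinAt
  · intro ζ hζ
    have hre : ζ.re < 0 := by
      have := hζ.1
      simp only [Set.mem_preimage, Set.mem_Ioo, max_eq_right (show -R ≤ 0 by linarith)] at this
      exact this.2
    have hne : exp ζ ≠ 1 := by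
      intro h
      have := congrArg norm h
      rw [norm_exp, norm_one, Real.exp_eq_one_iff] at this
      linarith
    have h1 : DifferentiableAt ℂ (fun ζ => (1 - exp ζ) ^ (-s)) ζ :=
      DifferentiableAt.cpow_const (by fun_prop) (one_sub_exp_mem_slitPlane hne hre.le)
    exact (DifferentiableAt.mul (by fun_prop) h1).differentiableWithinAt

lemma integral_segment_eq (a : ℂ) {s : ℂ} (hs : s.re < 0) {R : ℝ} (hR : 0 ≤ R) :
    (∫ x in (-R)..0, exp (a * x) * (1 - exp (x : ℂ)) ^ (-s)) =
      ∫ u in (Real.exp (-R))..1, (u : ℂ) ^ (a - 1) * (1 - (u : ℂ)) ^ (1 - s - 1) := by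
  have h := intervalIntegral.integral_deriv_smul_comp' (a := -R) (b := 0) (f := Real.exp)
    (f' := Real.exp) (g := fun u : ℝ => (u : ℂ) ^ (a - 1) * (1 - (u : ℂ)) ^ (1 - s - 1))
    (fun x _ => Real.hasDerivAt_exp x) Real.continuous_exp.continuousOn ?_
  · rw [Real.exp_zero] at h
    rw [← h]
    congr 1; ext x
    have h0 : ((Real.exp x : ℝ) : ℂ) ≠ 0 := by exact_mod_cast (Real.exp_pos x).ne'
    simp only [Function.comp, real_smul]
    rw [cpow_def_of_ne_zero h0, ← ofReal_log (Real.exp_pos x).le, Real.log_exp, ofReal_exp,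
      ← mul_assoc, ← exp_add, show 1 - s - 1 = -s by ring]
    ring_nf
  · rintro u ⟨x, hx, rfl⟩
    rw [Set.uIcc_of_le (by linarith)] at hx
    have h1 : ContinuousAt (fun u : ℝ => (u : ℂ) ^ (a - 1)) (Real.exp x) :=
      continuousAt_ofReal_cpow_const _ _ (Or.inr (Real.exp_pos x).ne')
    have h2 : ContinuousAt (fun u : ℝ => (1 - (u : ℂ)) ^ (1 - s - 1)) (Real.exp x) := by
      refine (continuousAt_cpow_const_of_re_pos (Or.inl ?_) ?_).comp
        (f := fun u : ℝ => 1 - (u : ℂ)) (by fun_prop)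
      · have := Real.exp_le_one_iff.mpr hx.2
        simp only [sub_re, one_re, ofReal_re]; linarith
      · simpa using hs
    exact (h1.mul h2).continuousWithinAt

lemma tendsto_integral_segment {a s : ℂ} (ha : 0 < a.re) (hs : s.re < 0) :
    Tendsto (fun R : ℝ => ∫ x in (-R)..0, exp (a * x) * (1 - exp (x : ℂ)) ^ (-s)) atTop
      (𝓝 (betaIntegral a (1 - s))) := by
  have hint : IntervalIntegrable
      (fun u : ℝ => (u : ℂ) ^ (a - 1) * (1 - (u : ℂ)) ^ (1 - s - 1)) volume 1 0 :=
    (betaIntegral_convergent ha (by simp; linarith)).symm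
  have hc := intervalIntegral.continuousOn_primitive_interval' hint Set.left_mem_uIcc
  rw [Set.uIcc_of_ge zero_le_one] at hc
  have h0 : Tendsto (fun R : ℝ => Real.exp (-R)) atTop (𝓝[Set.Icc 0 1] 0) := by
    refine tendsto_nhdsWithin_iff.mpr ⟨Real.tendsto_exp_neg_atTop_nhds_zero, ?_⟩
    filter_upwards [eventually_ge_atTop 0] with R hR
    exact ⟨(Real.exp_pos _).le, Real.exp_le_one_iff.mpr (by linarith)⟩
  have h1 := ((hc 0 ⟨le_rfl, zero_le_one⟩).tendsto.comp h0).neg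
  rw [← intervalIntegral.integral_symm] at h1
  refine h1.congr' ?_
  filter_upwards [eventually_ge_atTop 0] with R hR
  rw [integral_segment_eq a hs hR, intervalIntegral.integral_symm]
  rfl

lemma tendsto_integral_circle {a s : ℂ} (ha : 0 < a.re) (hs : s.re < 0) :
    Tendsto (fun R : ℝ => ∫ y in (0 : ℝ)..(2 * Real.pi),
      exp (a * (((-R : ℝ) : ℂ) + y * I)) * (1 - exp (((-R : ℝ) : ℂ) + y * I)) ^ (-s)) atTop
      (𝓝 0) := by
  have hp := Real.pi_pos
  set K : ℝ := Real.exp (2 * Real.pi * |a.im|) * (2 ^ (-s.re) * Real.exp (Real.pi * |s.im|)) *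
    |2 * Real.pi - 0| with hK
  have hbound : ∀ᶠ R : ℝ in atTop, ‖∫ y in (0 : ℝ)..(2 * Real.pi),
      exp (a * (((-R : ℝ) : ℂ) + y * I)) * (1 - exp (((-R : ℝ) : ℂ) + y * I)) ^ (-s)‖ ≤
      Real.exp (-(a.re * R)) * K := by
    filter_upwards [eventually_ge_atTop 0] with R hR
    rw [hK, ← mul_assoc, ← mul_assoc]
    refine intervalIntegral.norm_integral_le_of_norm_le_const fun y hy => ?_
    rw [Set.uIoc_of_le (by positivity)] at hy
    rw [norm_mul]
    have h1 : ‖exp (a * (((-R : ℝ) : ℂ) + y * I))‖ ≤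
        Real.exp (-(a.re * R)) * Real.exp (2 * Real.pi * |a.im|) := by
      rw [mul_add, exp_add, norm_mul]
      have e1 : a * (y * I) = I * a * (y : ℂ) := by ring
      rw [e1]
      gcongr
      · rw [norm_exp]; simp
      · exact norm_exp_I_mul_le a hy.1.le hy.2
    have h2 := norm_cpow_neg_le_of_re_nonpos (ζ := ((-R : ℝ) : ℂ) + y * I) (s := s)
      (by simpa using hR) hs.le
    gcongr
  refine squeeze_zero_norm' hbound ?_
  have h1 : Tendsto (fun R : ℝ => Real.exp (-(a.re * R))) atTop (𝓝 0) :=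
    Real.tendsto_exp_neg_atTop_nhds_zero.comp (tendsto_id.const_mul_atTop ha)
  simpa using h1.mul_const K

lemma loopIntegral_eq_betaIntegral {a s : ℂ} (ha : 0 < a.re) (hs : s.re < 0) :
    I * loopIntegral a s = (exp (2 * Real.pi * I * a) - 1) * betaIntegral a (1 - s) := by
  have h1 := ((tendsto_integral_segment ha hs).const_mul (exp (2 * Real.pi * I * a) - 1)).add
    ((tendsto_integral_circle ha hs).const_mul I)
  rw [mul_zero, add_zero] at h1
  refine tendsto_nhds_unique (tendsto_const_nhds.congr' ?_) h1
  filter_upwards [eventually_ge_atTop 0] with R hR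
  exact loopIntegral_eq_segment_add_circle a hs hR

/-- Euler's reflection formula turns the factor `e^{2πia} - 1` of the two sides of the cut into
`1 / Γ(1 - a)`. -/
lemma exp_sub_one_mul_Gamma {a : ℂ} (ha : 0 < a.re) :
    (exp (2 * Real.pi * I * a) - 1) * Gamma a =
      I * (exp (Real.pi * I * a) * (2 * Real.pi * (Gamma (1 - a))⁻¹)) := by
  have hG : Gamma a ≠ 0 := Gamma_ne_zero_of_re_pos ha
  have hsin : exp (2 * Real.pi * I * a) - 1 =
      2 * I * exp (Real.pi * I * a) * sin (Real.pi * a) := by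
    have e1 : exp (2 * Real.pi * I * a) = exp (Real.pi * I * a) * exp (Real.pi * I * a) := by
      rw [← exp_add]; ring_nf
    have e2 : exp (-(Real.pi * a) * I) = (exp (Real.pi * I * a))⁻¹ := by
      rw [← exp_neg]; ring_nf
    have e3 : exp (Real.pi * a * I) = exp (Real.pi * I * a) := by ring_nf
    rw [sin, e2, e3, e1]
    have := exp_ne_zero (Real.pi * I * a)
    field_simp
    rw [I_sq]
    ring
  have hrefl := Gamma_mul_Gamma_one_sub a
  have hp : (Real.pi : ℂ) ≠ 0 := by exact_mod_cast Real.pi_ne_zero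
  rw [hsin]
  by_cases h : sin (Real.pi * a) = 0
  · rw [h, div_zero] at hrefl
    have : Gamma (1 - a) = 0 := (mul_eq_zero.mp hrefl).resolve_left hG
    simp [h, this]
  · have h1 : Gamma (1 - a) ≠ 0 := by
      intro h0
      rw [h0, mul_zero] at hrefl
      exact div_ne_zero hp h hrefl.symm
    rw [eq_div_iff h] at hrefl
    field_simp
    linear_combination hrefl

lemma loopIntegral_eq_of_re_neg {a s : ℂ} (ha : 0 < a.re) (hs : s.re < 0) :
    loopIntegral a s = loopBeta a s := by
  have hs' : 0 < (1 - s).re := by simp; linarith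
  have h1 := loopIntegral_eq_betaIntegral ha hs
  have h2 := Gamma_mul_Gamma_eq_betaIntegral ha hs'
  have h3 : Gamma (a + (1 - s)) ≠ 0 := Gamma_ne_zero_of_re_pos (by rw [add_re]; linarith)
  have h4 : betaIntegral a (1 - s) = Gamma a * Gamma (1 - s) * (Gamma (a + (1 - s)))⁻¹ := by
    rw [h2]; field_simp
  rw [h4] at h1
  refine mul_left_cancel₀ I_ne_zero ?_
  rw [h1, loopBeta, show a - s + 1 = a + (1 - s) by ring]
  linear_combination (Gamma (1 - s) * (Gamma (a + (1 - s)))⁻¹) * exp_sub_one_mul_Gamma ha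

lemma loopBeta_shift (a : ℂ) {s : ℂ} (hs : s ≠ 1) :
    (1 - s) * loopBeta a s = (a - 1) * loopBeta (a - 1) (s - 1) := by
  unfold loopBeta
  have e1 : Gamma (1 - (s - 1)) = (1 - s) * Gamma (1 - s) := by
    rw [← Gamma_add_one _ (sub_ne_zero.mpr hs.symm)]; ring_nf
  have e2 : (Gamma (1 - a))⁻¹ = (1 - a) * (Gamma (1 - (a - 1)))⁻¹ := by
    rw [one_div_Gamma_eq_self_mul_one_div_Gamma_add_one]; ring_nf
  have e3 : exp (Real.pi * I * (a - 1)) = -exp (Real.pi * I * a) := by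
    rw [mul_sub, mul_one, exp_sub, exp_pi_mul_I]; ring
  rw [e1, e2, e3, show a - 1 - (s - 1) + 1 = a - s + 1 by ring]
  ring

lemma loopBeta_add_one (a s : ℂ) :
    (1 - s + a) * loopBeta (a + 1) s = a * loopBeta a s := by
  unfold loopBeta
  have e1 : (Gamma (a - s + 1))⁻¹ = (a - s + 1) * (Gamma (a + 1 - s + 1))⁻¹ := by
    rw [one_div_Gamma_eq_self_mul_one_div_Gamma_add_one]; ring_nf
  have e2 : (Gamma (1 - (a + 1)))⁻¹ = -a * (Gamma (1 - a))⁻¹ := by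
    rw [one_div_Gamma_eq_self_mul_one_div_Gamma_add_one]; ring_nf
  have e3 : exp (Real.pi * I * (a + 1)) = -exp (Real.pi * I * a) := by
    rw [mul_add, mul_one, exp_add, exp_pi_mul_I]; ring
  rw [e1, e2, e3]
  ring

lemma continuous_loopBeta (s : ℂ) : Continuous fun a => loopBeta a s := by
  unfold loopBeta
  have h1 : Continuous fun a : ℂ => (Gamma (a - s + 1))⁻¹ :=
    differentiable_one_div_Gamma.continuous.comp (by fun_prop : Continuous fun a : ℂ => a - s + 1)
  have h2 : Continuous fun a : ℂ => (Gamma (1 - a))⁻¹ :=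
    differentiable_one_div_Gamma.continuous.comp (by fun_prop : Continuous fun a : ℂ => 1 - a)
  fun_prop

/-- The loop integral in closed form. It is reached from the range of Euler's Beta integral by
the contiguity relations in `s` and in `a`; the second one says nothing at `a = 0`, where
continuity is used. -/
theorem loopIntegral_eq_loopBeta (a : ℂ) {s : ℂ} (hs : s.re < 1) :
    loopIntegral a s = loopBeta a s := by
  have hne : 1 - s ≠ 0 := by intro h; have := congrArg re h; simp at this; linarith
  have base : ∀ a : ℂ, 1 < a.re → loopIntegral a s = loopBeta a s := by
    intro a ha
    refine mul_left_cancel₀ hne ?_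
    rw [loopIntegral_shift a hs, loopBeta_shift a (sub_ne_zero.mp hne).symm,
      loopIntegral_eq_of_re_neg (by simp; linarith) (by simp; linarith)]
  have step : ∀ a : ℂ, a ≠ 0 → loopIntegral (a + 1) s = loopBeta (a + 1) s →
      loopIntegral a s = loopBeta a s := by
    intro a ha h
    refine mul_left_cancel₀ ha ?_
    rw [← loopBeta_add_one, ← h]
    have h1 := loopIntegral_shift (a + 1) hs
    rw [add_sub_cancel_right, loopIntegral_sub_one a hs] at h1
    linear_combination -h1
  have main : ∀ n : ℕ, ∀ a : ℂ, 1 < a.re + n → loopIntegral a s = loopBeta a s := by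
    intro n
    induction n with
    | zero => intro a ha; exact base a (by simpa using ha)
    | succ n ih =>
      intro a ha
      have hstep : ∀ b : ℂ, b ≠ 0 → 1 < b.re + ((n + 1 : ℕ) : ℝ) →
          loopIntegral b s = loopBeta b s := fun b hb hb' =>
        step b hb (ih (b + 1) (by push_cast at hb'; simp; linarith))
      by_cases h0 : a = 0
      · subst h0
        have h1 : ∀ᶠ b : ℂ in 𝓝[≠] 0, loopIntegral b s = loopBeta b s := by
          have h2 : ∀ᶠ b : ℂ in 𝓝 (0 : ℂ), 1 < b.re + ((n + 1 : ℕ) : ℝ) :=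
            (by fun_prop : Continuous fun b : ℂ => b.re + ((n + 1 : ℕ) : ℝ)).continuousAt.eventually
              (lt_mem_nhds ha)
          filter_upwards [self_mem_nhdsWithin, h2.filter_mono nhdsWithin_le_nhds] with b hb hb'
          exact hstep b hb hb'
        exact tendsto_nhds_unique
          (((continuous_loopIntegral hs).continuousAt (x := 0)).tendsto.mono_left
            nhdsWithin_le_nhds)
          ((((continuous_loopBeta s).continuousAt (x := 0)).tendsto.mono_left
            nhdsWithin_le_nhds).congr' (h1.mono fun b hb => hb.symm))
      · exact hstep a h0 ha
  obtain ⟨n, hn⟩ := exists_nat_gt (1 - a.re)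
  exact main n a (by linarith)

/-! ### Growth and analyticity of the loop integral -/

lemma norm_loopBeta_le_of_re_nonpos (a : ℂ) {s : ℂ} (hs : s.re ≤ 0) :
    ‖loopBeta a s‖ ≤ Real.exp (2 * Real.pi * |a.im|) *
      (2 ^ (-s.re) * Real.exp (Real.pi * |s.im|)) * |2 * Real.pi - 0| := by
  rw [← loopIntegral_eq_loopBeta a (by linarith)]
  refine intervalIntegral.norm_integral_le_of_norm_le_const fun θ hθ => ?_
  rw [Set.uIoc_of_le (by positivity)] at hθ
  unfold loopIntegrand
  rw [norm_mul]
  have h1 := norm_exp_I_mul_le a hθ.1.le hθ.2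
  have h2 := norm_cpow_neg_le_of_re_nonpos (re_I_mul_ofReal θ).le hs
  gcongr

/-- The set of values `s = 1/κ` that are not positive integers. -/
def regularSet : Set ℂ := {s | ∀ k : ℕ, s ≠ (k : ℂ) + 1}

lemma isOpen_regularSet : IsOpen regularSet := by
  have h : regularSet = ((fun s : ℂ => s - 1) ⁻¹' (Set.range ((↑) : ℕ → ℂ)))ᶜ := by
    ext s
    simp only [regularSet, Set.mem_ofPred_eq, Set.mem_compl_iff, Set.mem_preimage, Set.mem_range,
      not_exists]
    exact forall_congr' fun k => not_congr ⟨fun h => by rw [h]; ring, fun h => by rw [h]; ring⟩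
  rw [h, isOpen_compl_iff]
  refine IsClosed.preimage (by fun_prop) ?_
  have hd : Pairwise fun m n : ℕ => 1 ≤ dist (m : ℂ) (n : ℂ) := by
    intro m n hmn
    have h1 : 1 ≤ dist m n := Nat.pairwise_one_le_dist hmn
    change 1 ≤ dist (m : ℂ) (n : ℂ)
    rw [Nat.dist_eq] at h1
    rw [Complex.dist_eq, ← ofReal_natCast m, ← ofReal_natCast n, ← ofReal_sub, norm_real]
    exact h1
  exact (Metric.isClosedEmbedding_of_pairwise_le_dist zero_lt_one hd).isClosed_range

lemma differentiableAt_Gamma_one_sub {s : ℂ} (hs : s ∈ regularSet) :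
    DifferentiableAt ℂ (fun s => Gamma (1 - s)) s := by
  refine DifferentiableAt.comp s (f := fun s : ℂ => 1 - s) (differentiableAt_Gamma _ fun m h => ?_)
    (by fun_prop)
  exact hs m (by linear_combination -h)

lemma differentiableOn_loopBeta (α γ : ℂ) :
    DifferentiableOn ℂ (fun s => loopBeta (s * α + γ) s) regularSet := by
  intro s hs
  refine DifferentiableAt.differentiableWithinAt ?_
  unfold loopBeta
  have h0 := differentiableAt_Gamma_one_sub hs
  have h1 : DifferentiableAt ℂ (fun s : ℂ => (Gamma (s * α + γ - s + 1))⁻¹) s :=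
    (differentiable_one_div_Gamma _).comp s
      (by fun_prop : DifferentiableAt ℂ (fun s : ℂ => s * α + γ - s + 1) s)
  have h2 : DifferentiableAt ℂ (fun s : ℂ => (Gamma (1 - (s * α + γ)))⁻¹) s :=
    (differentiable_one_div_Gamma _).comp s
      (by fun_prop : DifferentiableAt ℂ (fun s : ℂ => 1 - (s * α + γ)) s)
  fun_prop

/-- `D`-fold integration by parts bounds the continued loop integral for `Re s ≤ D` by a
polynomial in `‖a‖`, apart from a factor that depends on `Im a` only. -/
lemma norm_loopBeta_le (D : ℕ) : ∀ a s : ℂ, s ∈ regularSet → s.re ≤ D →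
    ‖loopBeta a s‖ ≤ Real.exp (2 * Real.pi * |a.im|) *
      (2 ^ (D - s.re) * Real.exp (Real.pi * |s.im|)) * |2 * Real.pi - 0| *
      ∏ i ∈ Finset.range D, ((‖a‖ + D) / ‖(i : ℂ) + 1 - s‖) := by
  induction D with
  | zero =>
    intro a s _ hs
    have := norm_loopBeta_le_of_re_nonpos a (s := s) (by simpa using hs)
    simpa using this
  | succ D ih =>
    intro a s hs hre
    have hs1 : s ≠ 1 := by simpa using hs 0
    have hreg : s - 1 ∈ regularSet := fun k h => hs (k + 1) (by push_cast; linear_combination h)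
    have h1 := ih (a - 1) (s - 1) hreg (by push_cast at hre; simp; linarith)
    have hpos : 0 < ‖1 - s‖ := norm_pos_iff.mpr (sub_ne_zero.mpr hs1.symm)
    have h2 : ‖loopBeta a s‖ = ‖a - 1‖ / ‖1 - s‖ * ‖loopBeta (a - 1) (s - 1)‖ := by
      have := congrArg norm (loopBeta_shift a hs1)
      rw [norm_mul, norm_mul] at this
      field_simp
      linarith
    have h3 : ‖a - 1‖ ≤ ‖a‖ + 1 := (norm_sub_le _ _).trans (by rw [norm_one])
    have e1 : ((D : ℕ) : ℝ) - (s - 1).re = ((D + 1 : ℕ) : ℝ) - s.re := by push_cast; simp; ring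
    rw [e1] at h1
    simp only [sub_im, one_im, sub_zero] at h1
    rw [Finset.prod_range_succ', h2]
    have h4 : ∏ i ∈ Finset.range D, ((‖a - 1‖ + D) / ‖(i : ℂ) + 1 - (s - 1)‖) ≤
        ∏ i ∈ Finset.range D, ((‖a‖ + ((D + 1 : ℕ) : ℝ)) / ‖((i + 1 : ℕ) : ℂ) + 1 - s‖) := by
      refine Finset.prod_le_prod (fun i _ => by positivity) fun i _ => ?_
      rw [show ((i + 1 : ℕ) : ℂ) + 1 - s = (i : ℂ) + 1 - (s - 1) by push_cast; ring]
      refine div_le_div_of_nonneg_right ?_ (norm_nonneg _)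
      push_cast
      linarith
    have h5 : ‖a - 1‖ / ‖1 - s‖ ≤ (‖a‖ + ((D + 1 : ℕ) : ℝ)) / ‖((0 : ℕ) : ℂ) + 1 - s‖ := by
      rw [show ((0 : ℕ) : ℂ) + 1 - s = 1 - s by simp]
      gcongr
      push_cast
      have : (0 : ℝ) ≤ D := by positivity
      linarith
    simp only [sub_zero] at h1 ⊢
    calc ‖a - 1‖ / ‖1 - s‖ * ‖loopBeta (a - 1) (s - 1)‖
        ≤ (‖a‖ + ((D + 1 : ℕ) : ℝ)) / ‖((0 : ℕ) : ℂ) + 1 - s‖ *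
          (Real.exp (2 * Real.pi * |a.im|) *
            (2 ^ (((D + 1 : ℕ) : ℝ) - s.re) * Real.exp (Real.pi * |s.im|)) * |2 * Real.pi| *
          ∏ i ∈ Finset.range D, ((‖a‖ + ((D + 1 : ℕ) : ℝ)) / ‖((i + 1 : ℕ) : ℂ) + 1 - s‖)) := by
          refine mul_le_mul h5 (h1.trans ?_) (norm_nonneg _) (by positivity)
          gcongr
      _ = _ := by ring

/-- Locally uniformly in `s`, the continued loop integral grows at most polynomially under integral
translations of `a`. -/
lemma exists_norm_loopBeta_le (α : ℂ) {s₀ : ℂ} (hs₀ : s₀ ∈ regularSet) :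
    ∃ K : ℝ, 0 ≤ K ∧ ∃ D : ℕ, ∀ᶠ s in 𝓝 s₀, ∀ k : ℤ,
      ‖loopBeta (s * α + k) s‖ ≤ K * (1 + |(k : ℝ)|) ^ D := by
  obtain ⟨D, hD⟩ := exists_nat_gt s₀.re
  set H : ℂ → ℝ := fun s => Real.exp (2 * Real.pi * |(s * α).im|) *
      (2 ^ (D - s.re) * Real.exp (Real.pi * |s.im|)) * |2 * Real.pi - 0| *
      ∏ i ∈ Finset.range D, ((‖s * α‖ + D + 1) / ‖(i : ℂ) + 1 - s‖) with hH
  have hHc : ContinuousAt H s₀ := by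
    have h1 : ∀ i ∈ Finset.range D,
        ContinuousAt (fun s : ℂ => (‖s * α‖ + D + 1) / ‖(i : ℂ) + 1 - s‖) s₀ := fun i _ =>
      ContinuousAt.div (by fun_prop) (by fun_prop)
        (norm_ne_zero_iff.mpr (sub_ne_zero.mpr (hs₀ i).symm))
    have h2 : ContinuousAt (fun s : ℂ => (2 : ℝ) ^ ((D : ℝ) - s.re)) s₀ :=
      ContinuousAt.rpow (by fun_prop) (by fun_prop) (Or.inl two_ne_zero)
    have h3 : ContinuousAt (fun s : ℂ => ∏ i ∈ Finset.range D,
        ((‖s * α‖ + D + 1) / ‖(i : ℂ) + 1 - s‖)) s₀ := tendsto_finsetProd _ h1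
    exact ((ContinuousAt.mul (by fun_prop) (h2.mul (by fun_prop))).mul (by fun_prop)).mul h3
  refine ⟨|H s₀ + 1|, abs_nonneg _, D, ?_⟩
  have e1 : ∀ᶠ s : ℂ in 𝓝 s₀, s.re < (D : ℝ) :=
    continuous_re.continuousAt.eventually (gt_mem_nhds hD)
  filter_upwards [hHc.eventually (gt_mem_nhds (lt_add_one (H s₀))), e1,
    isOpen_regularSet.mem_nhds hs₀] with s hs1 hs2 hs3 k
  refine (norm_loopBeta_le D _ s hs3 hs2.le).trans ?_
  have him : (s * α + k).im = (s * α).im := by simp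
  have hprod : ∏ i ∈ Finset.range D, ((‖s * α + k‖ + D) / ‖(i : ℂ) + 1 - s‖) ≤
      (∏ i ∈ Finset.range D, ((‖s * α‖ + D + 1) / ‖(i : ℂ) + 1 - s‖)) *
        (1 + |(k : ℝ)|) ^ D := by
    have : (1 + |(k : ℝ)|) ^ D = ∏ i ∈ Finset.range D, (1 + |(k : ℝ)|) := by simp
    rw [this, ← Finset.prod_mul_distrib]
    refine Finset.prod_le_prod (fun i _ => by positivity) fun i _ => ?_
    rw [div_mul_eq_mul_div]
    gcongr
    have h1 : ‖s * α + k‖ ≤ ‖s * α‖ + |(k : ℝ)| := by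
      refine (norm_add_le _ _).trans ?_
      rw [norm_intCast]
    have h2 : 0 ≤ |(k : ℝ)| := abs_nonneg _
    have h3 : 0 ≤ ‖s * α‖ := norm_nonneg _
    have h4 : (0 : ℝ) ≤ D := by positivity
    nlinarith [mul_nonneg h3 h2, mul_nonneg h4 h2]
  rw [him]
  calc _ ≤ Real.exp (2 * Real.pi * |(s * α).im|) *
      (2 ^ (D - s.re) * Real.exp (Real.pi * |s.im|)) * |2 * Real.pi - 0| *
      ((∏ i ∈ Finset.range D, ((‖s * α‖ + D + 1) / ‖(i : ℂ) + 1 - s‖)) *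
        (1 + |(k : ℝ)|) ^ D) := by gcongr
    _ = H s * (1 + |(k : ℝ)|) ^ D := by rw [hH]; ring
    _ ≤ |H s₀ + 1| * (1 + |(k : ℝ)|) ^ D := by
      gcongr
      exact hs1.le.trans (le_abs_self _)

/-! ### The binomial series -/

/-- The coefficient of `x ^ m` in `(1 - x) ^ b`. -/
noncomputable def binomCoeff (b : ℂ) (m : ℕ) : ℂ := ∏ i ∈ Finset.range m, ((i - b) / ((i : ℂ) + 1))

lemma binomCoeff_zero (b : ℂ) : binomCoeff b 0 = 1 := by simp [binomCoeff]

lemma binomCoeff_eq_choose (b : ℂ) (m : ℕ) : binomCoeff b m = (-1) ^ m * Ring.choose b m := by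
  have h : ∀ m : ℕ, (descPochhammer ℤ m).smeval b = ∏ i ∈ Finset.range m, (b - i) := by
    intro m
    induction m with
    | zero => simp
    | succ m ih =>
      rw [descPochhammer_succ_right, Polynomial.smeval_mul, ih, Finset.prod_range_succ,
        Polynomial.smeval_sub, Polynomial.smeval_X, Polynomial.smeval_natCast]
      simp
  rw [Ring.choose_eq_smul, h, binomCoeff, Finset.prod_div_distrib, smul_eq_mul]
  have h1 : ∏ i ∈ Finset.range m, ((i : ℂ) - b) =
      (-1) ^ m * ∏ i ∈ Finset.range m, (b - i) := by
    have : (-1 : ℂ) ^ m = ∏ i ∈ Finset.range m, (-1 : ℂ) := by simp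
    rw [this, ← Finset.prod_mul_distrib]
    exact Finset.prod_congr rfl fun i _ => by ring
  have h2 : ∏ i ∈ Finset.range m, ((i : ℂ) + 1) = (m.factorial : ℂ) := by
    rw [← Finset.prod_range_add_one_eq_factorial]; push_cast; rfl
  rw [h1, h2]
  ring

lemma hasSum_one_sub_cpow (b : ℂ) {x : ℂ} (hx : ‖x‖ < 1) :
    HasSum (fun m => binomCoeff b m * x ^ m) ((1 - x) ^ b) := by
  have h := (one_add_cpow_hasFPowerSeriesOnBall_zero (a := b)).hasSum (y := -x)
    (by simpa [← ofReal_norm] using hx)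
  rw [zero_add, ← sub_eq_add_neg] at h
  refine h.congr_fun fun m => ?_
  rw [binomCoeff_eq_choose, binomialSeries_apply]
  simp only [List.ofFn_const, List.prod_replicate, smul_eq_mul]
  rw [neg_pow]
  ring

/-- By Bernoulli's inequality, passing from `m` to `m + 1` costs at most `((m + 2) / (m + 1)) ^ M`. -/
lemma norm_binomCoeff_le {b : ℂ} {M : ℕ} (hb : ‖b‖ ≤ M) (m : ℕ) :
    ‖binomCoeff b m‖ ≤ ((m : ℝ) + 1) ^ M := by
  induction m with
  | zero => simp [binomCoeff]
  | succ m ih =>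
    have h1 : ‖((m : ℂ) - b) / ((m : ℂ) + 1)‖ ≤ (((m : ℝ) + 2) / (m + 1)) ^ M := by
      have hm : ‖(m : ℂ) + 1‖ = (m : ℝ) + 1 := by
        rw [← Nat.cast_succ, norm_natCast]; push_cast; rfl
      have h2 : ‖(m : ℂ) - b‖ ≤ m + M := by
        refine (norm_sub_le _ _).trans ?_
        rw [norm_natCast]; linarith
      have h3 := one_add_mul_le_pow (a := 1 / ((m : ℝ) + 1)) (by
        have : 0 ≤ 1 / ((m : ℝ) + 1) := by positivity
        linarith) M
      rw [norm_div, hm]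
      calc ‖(m : ℂ) - b‖ / ((m : ℝ) + 1) ≤ (m + M) / ((m : ℝ) + 1) := by gcongr
        _ ≤ 1 + M * (1 / ((m : ℝ) + 1)) := by
          rw [div_le_iff₀ (by positivity)]; field_simp; linarith
        _ ≤ (1 + 1 / ((m : ℝ) + 1)) ^ M := h3
        _ = _ := by congr 1; field_simp; ring
    rw [binomCoeff, Finset.prod_range_succ, norm_mul, ← binomCoeff]
    calc _ ≤ ((m : ℝ) + 1) ^ M * (((m : ℝ) + 2) / (m + 1)) ^ M := by gcongr
      _ = _ := by rw [← mul_pow]; congr 1; field_simp; push_cast; ring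

lemma differentiable_binomCoeff (β : ℂ) (m : ℕ) :
    Differentiable ℂ fun s => binomCoeff (s * β) m := by
  unfold binomCoeff
  refine Differentiable.fun_finsetProd fun i _ => ?_
  fun_prop

/-! ### Products of absolutely convergent series -/

/-- A finite product of absolutely convergent series, expanded. -/
lemma hasSum_pi_prod {R : Type*} [NormedField R] [CompleteSpace R] {P : Type*} [Fintype P]
    (f : P → ℕ → R) (hf : ∀ p, Summable fun k => ‖f p k‖) :
    (Summable fun m : P → ℕ => ‖∏ p, f p (m p)‖) ∧
      HasSum (fun m : P → ℕ => ∏ p, f p (m p)) (∏ p, ∑' k, f p k) := by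
  have fin : ∀ (n : ℕ) (f : Fin n → ℕ → R), (∀ p, Summable fun k => ‖f p k‖) →
      (Summable fun m : Fin n → ℕ => ‖∏ p, f p (m p)‖) ∧
      HasSum (fun m : Fin n → ℕ => ∏ p, f p (m p)) (∏ p, ∑' k, f p k) := by
    intro n
    induction n with
    | zero =>
      intro f _
      simp only [Finset.univ_eq_empty, Finset.prod_empty]
      refine ⟨(hasSum_fintype _).summable, ?_⟩
      simp
    | succ n ih =>
      intro f hf
      have h := ih (fun a => f a.succ) fun a => hf a.succ
      have hs := (hf 0).mul_norm h.1
      have e1 : ∀ x : ℕ × (Fin n → ℕ), ∏ p, f p (Fin.consEquiv (fun _ => ℕ) x p) =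
          f 0 x.1 * ∏ a, f (Fin.succ a) (x.2 a) := by
        intro x
        rw [Fin.prod_univ_succ]
        rfl
      refine ⟨?_, ?_⟩
      · rw [← (Fin.consEquiv fun _ => ℕ).summable_iff]
        simpa only [Function.comp_def, e1] using hs
      · rw [Fin.prod_univ_succ, ← (Fin.consEquiv fun _ => ℕ).hasSum_iff]
        have h2 := (hf 0).of_norm.hasSum.mul h.2 hs.of_norm
        simpa only [Function.comp_def, e1] using h2
  have e := Fintype.equivFin P
  have h := fin _ (fun a => f (e.symm a)) fun a => hf (e.symm a)
  have e1 : ∀ m : P → ℕ, ∏ a, f (e.symm a) ((e.arrowCongr (Equiv.refl ℕ)) m a) =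
      ∏ b, f b (m b) := by
    intro m
    rw [← e.symm.prod_comp]
    rfl
  have e2 : ∏ a, ∑' k, f (e.symm a) k = ∏ b, ∑' k, f b k :=
    e.symm.prod_comp fun b => ∑' k, f b k
  refine ⟨?_, ?_⟩
  · rw [← (e.arrowCongr (Equiv.refl ℕ)).summable_iff] at h
    simpa only [Function.comp_def, e1] using h.1
  · rw [← (e.arrowCongr (Equiv.refl ℕ)).hasSum_iff, e2] at h
    simpa only [Function.comp_def, e1] using h.2

lemma summable_succ_pow_mul_geometric (E : ℕ) {ρ : ℝ} (h0 : 0 ≤ ρ) (h1 : ρ < 1) :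
    Summable fun m : ℕ => ((m : ℝ) + 1) ^ E * ρ ^ m := by
  have hρ : ‖ρ‖ < 1 := by rwa [Real.norm_of_nonneg h0]
  have h2 := ((summable_pow_mul_geometric_of_norm_lt_one E hρ).add
    (summable_geometric_of_norm_lt_one hρ)).mul_left ((2 : ℝ) ^ E)
  refine Summable.of_nonneg_of_le (fun m => by positivity) (fun m => ?_) h2
  rw [← add_one_mul, ← mul_assoc]
  gcongr
  rcases Nat.eq_zero_or_pos m with rfl | hm
  · simp only [Nat.cast_zero, zero_add, one_pow]
    have h3 : (1 : ℝ) ≤ 2 ^ E := one_le_pow₀ one_le_two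
    have h4 : (0 : ℝ) ≤ 0 ^ E := by positivity
    nlinarith
  · have hm' : (1 : ℝ) ≤ m := by exact_mod_cast hm
    calc ((m : ℝ) + 1) ^ E ≤ (2 * m) ^ E := by gcongr; linarith
      _ = 2 ^ E * (m : ℝ) ^ E := mul_pow _ _ _
      _ ≤ _ := by gcongr; linarith

lemma summable_pi_succ_pow_mul_geometric {P : Type*} [Fintype P] (E : ℕ) {ρ : P → ℝ}
    (h0 : ∀ p, 0 ≤ ρ p) (h1 : ∀ p, ρ p < 1) :
    Summable fun m : P → ℕ => (∏ p, ((m p : ℝ) + 1) ^ E) * ∏ p, ρ p ^ m p := by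
  have h := (hasSum_pi_prod (fun (p : P) (k : ℕ) => ((k : ℝ) + 1) ^ E * ρ p ^ k) fun p => by
    simpa only using (summable_succ_pow_mul_geometric E (h0 p) (h1 p)).norm).2.summable
  simpa only [Finset.prod_mul_distrib] using h

/-! ### Products of loops with regular interactions -/

section LoopSeries

variable {V P : Type*} [Fintype P]

/-- The integer vector `∑ m_p k_p`. -/
def totalWinding (k : P → V → ℤ) (m : P → ℕ) (v : V) : ℤ := ∑ p, (m p : ℤ) * k p v

/-- The integrand on a product of loops, indexed by `V`: the loop integrands, singular at the ends of
the loops, times factors `(1 - r_p e^{i k_p·θ})^{s β_p}`, indexed by `P`, which are regular for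
`|r_p| < 1`. -/
noncomputable def modelIntegrand [Fintype V] (α : V → ℂ) (β : P → ℂ) (k : P → V → ℤ) (r : P → ℝ)
    (s : ℂ) (θ : V → ℝ) : ℂ :=
  (∏ v, loopIntegrand (s * α v) s (θ v)) *
    ∏ p, (1 - r p * exp (I * ∑ v, (k p v : ℂ) * θ v)) ^ (s * β p)

/-- The coefficient of `∏ r_p ^ m_p` in the integral of `modelIntegrand`. -/
noncomputable def seriesCoeff [Fintype V] (α : V → ℂ) (β : P → ℂ) (k : P → V → ℤ) (s : ℂ)
    (m : P → ℕ) : ℂ :=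
  (∏ p, binomCoeff (s * β p) (m p)) * ∏ v, loopBeta (s * α v + (totalWinding k m v : ℂ)) s

/-- The integral of `modelIntegrand` as a power series in `r`; it makes sense for all `s` that are
not positive integers. -/
noncomputable def loopSeries [Fintype V] (α : V → ℂ) (β : P → ℂ) (k : P → V → ℤ) (r : P → ℝ)
    (s : ℂ) : ℂ :=
  ∑' m : P → ℕ, seriesCoeff α β k s m * ∏ p, (r p : ℂ) ^ m p

lemma one_add_abs_totalWinding_le (k : P → V → ℤ) (m : P → ℕ) (v : V) :
    1 + |(totalWinding k m v : ℝ)| ≤ (1 + ∑ p, |(k p v : ℝ)|) * ∏ p, ((m p : ℝ) + 1) := by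
  have hT : ∀ p, (m p : ℝ) ≤ ∏ p, ((m p : ℝ) + 1) := by
    intro p
    have h := Finset.prod_le_prod_of_subset_of_one_le' (f := fun p => m p + 1)
      (Finset.subset_univ {p}) (fun i _ _ => by omega)
    rw [Finset.prod_singleton] at h
    have h' : m p ≤ ∏ p, (m p + 1) := by omega
    exact_mod_cast h'
  have h1 : (1 : ℝ) ≤ ∏ p, ((m p : ℝ) + 1) :=
    Finset.one_le_prod fun p _ => by
      have : (0 : ℝ) ≤ m p := by positivity
      linarith
  have h2 : |(totalWinding k m v : ℝ)| ≤ ∑ p, |(k p v : ℝ)| * ∏ p, ((m p : ℝ) + 1) := by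
    unfold totalWinding
    push_cast
    refine (Finset.abs_sum_le_sum_abs _ _).trans (Finset.sum_le_sum fun p _ => ?_)
    rw [abs_mul, mul_comm, Nat.abs_cast]
    gcongr
    exact hT p
  rw [add_mul, one_mul, Finset.sum_mul]
  linarith

variable [Fintype V]

lemma exists_norm_seriesCoeff_le (α : V → ℂ) (β : P → ℂ) (k : P → V → ℤ) {s₀ : ℂ}
    (hs₀ : s₀ ∈ regularSet) :
    ∃ K : ℝ, 0 ≤ K ∧ ∃ E : ℕ, ∀ᶠ s in 𝓝 s₀, ∀ m : P → ℕ,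
      ‖seriesCoeff α β k s m‖ ≤ K * ∏ p, ((m p : ℝ) + 1) ^ E := by
  choose K hK D hKD using fun v => exists_norm_loopBeta_le (α v) hs₀
  obtain ⟨M, hM⟩ := exists_nat_ge (∑ p, (‖s₀‖ + 1) * ‖β p‖)
  have hnear : ∀ᶠ s : ℂ in 𝓝 s₀, ‖s‖ < ‖s₀‖ + 1 :=
    continuous_norm.continuousAt.eventually (gt_mem_nhds (by linarith))
  refine ⟨∏ v, (K v * (1 + ∑ p, |(k p v : ℝ)|) ^ D v), ?_, M + ∑ v, D v, ?_⟩
  · exact Finset.prod_nonneg fun v _ => mul_nonneg (hK v) (by positivity)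
  filter_upwards [hnear, eventually_all.mpr hKD] with s hs hsD m
  have h1 : ‖∏ p, binomCoeff (s * β p) (m p)‖ ≤ ∏ p, ((m p : ℝ) + 1) ^ M := by
    rw [norm_prod]
    refine Finset.prod_le_prod (fun _ _ => norm_nonneg _) fun p _ => norm_binomCoeff_le ?_ _
    refine le_trans ?_ hM
    rw [norm_mul]
    calc ‖s‖ * ‖β p‖ ≤ (‖s₀‖ + 1) * ‖β p‖ := by gcongr
      _ ≤ _ := Finset.single_le_sum (f := fun p => (‖s₀‖ + 1) * ‖β p‖)
        (fun p _ => by positivity) (Finset.mem_univ p)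
  have h2 : ‖∏ v, loopBeta (s * α v + (totalWinding k m v : ℂ)) s‖ ≤
      ∏ v, (K v * (1 + ∑ p, |(k p v : ℝ)|) ^ D v * (∏ p, ((m p : ℝ) + 1)) ^ D v) := by
    rw [norm_prod]
    refine Finset.prod_le_prod (fun _ _ => norm_nonneg _) fun v _ => ?_
    refine (hsD v _).trans ?_
    rw [mul_assoc, ← mul_pow]
    have := hK v
    have := one_add_abs_totalWinding_le k m v
    gcongr
  unfold seriesCoeff
  rw [norm_mul]
  calc _ ≤ (∏ p, ((m p : ℝ) + 1) ^ M) *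
      ∏ v, (K v * (1 + ∑ p, |(k p v : ℝ)|) ^ D v * (∏ p, ((m p : ℝ) + 1)) ^ D v) := by gcongr
    _ = _ := by
      rw [Finset.prod_mul_distrib, Finset.prod_pow_eq_pow_sum, Finset.prod_pow, Finset.prod_pow,
        pow_add]
      ring

lemma differentiableOn_seriesCoeff (α : V → ℂ) (β : P → ℂ) (k : P → V → ℤ) (m : P → ℕ) :
    DifferentiableOn ℂ (fun s => seriesCoeff α β k s m) regularSet := by
  unfold seriesCoeff
  refine DifferentiableOn.mul ?_ ?_
  · exact DifferentiableOn.fun_finsetProd fun p _ =>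
      (differentiable_binomCoeff (β p) (m p)).differentiableOn
  · exact DifferentiableOn.fun_finsetProd fun v _ => differentiableOn_loopBeta (α v) _

lemma norm_prod_ofReal_pow (r : P → ℝ) (m : P → ℕ) :
    ‖∏ p, (r p : ℂ) ^ m p‖ = ∏ p, |r p| ^ m p := by
  rw [norm_prod]
  exact Finset.prod_congr rfl fun p _ => by rw [norm_pow, norm_real, Real.norm_eq_abs]

theorem differentiableOn_loopSeries (α : V → ℂ) (β : P → ℂ) (k : P → V → ℤ) {r : P → ℝ}
    (hr : ∀ p, |r p| < 1) : DifferentiableOn ℂ (loopSeries α β k r) regularSet := by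
  intro s₀ hs₀
  obtain ⟨K, hK, E, hE⟩ := exists_norm_seriesCoeff_le α β k hs₀
  obtain ⟨U, hU, hUo, hsU⟩ := eventually_nhds_iff.mp
    (hE.and (isOpen_regularSet.eventually_mem hs₀))
  have h := differentiableOn_tsum_of_summable_norm (U := U)
    (F := fun (m : P → ℕ) s => seriesCoeff α β k s m * ∏ p, (r p : ℂ) ^ m p)
    (u := fun m => K * ((∏ p, ((m p : ℝ) + 1) ^ E) * ∏ p, |r p| ^ m p))
    ((summable_pi_succ_pow_mul_geometric E (fun p => abs_nonneg (r p)) hr).mul_left K)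
    (fun m => ((differentiableOn_seriesCoeff α β k m).mono fun s hs => (hU s hs).2).mul_const _)
    hUo (fun m s hs => by
      rw [norm_mul, norm_prod_ofReal_pow, ← mul_assoc]
      have := (hU s hs).1 m
      gcongr)
  exact ((h s₀ hsU).differentiableAt (hUo.mem_nhds hsU)).differentiableWithinAt

lemma seriesCoeff_zero (α : V → ℂ) (β : P → ℂ) (k : P → V → ℤ) (s : ℂ) :
    seriesCoeff α β k s 0 = ∏ v, loopBeta (s * α v) s := by
  simp [seriesCoeff, binomCoeff_zero, totalWinding]

lemma loopSeries_zero (α : V → ℂ) (β : P → ℂ) (k : P → V → ℤ) (s : ℂ) :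
    loopSeries α β k 0 s = ∏ v, loopBeta (s * α v) s := by
  unfold loopSeries
  rw [tsum_eq_single 0, seriesCoeff_zero]
  · simp
  · intro m hm
    obtain ⟨p, hp⟩ := Function.ne_iff.mp hm
    rw [Finset.prod_eq_zero (Finset.mem_univ p) (by simpa using hp), mul_zero]

theorem tendsto_loopSeries (α : V → ℂ) (β : P → ℂ) (k : P → V → ℤ) {s : ℂ}
    (hs : s ∈ regularSet) :
    Tendsto (fun r => loopSeries α β k r s) (𝓝 0) (𝓝 (∏ v, loopBeta (s * α v) s)) := by
  obtain ⟨K, hK, E, hE⟩ := exists_norm_seriesCoeff_le α β k hs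
  have hE := hE.self_of_nhds
  rw [← loopSeries_zero α β k s]
  refine tendsto_tsum_of_dominated_convergence
    (bound := fun m => K * ((∏ p, ((m p : ℝ) + 1) ^ E) * ∏ p : P, (1 / 2 : ℝ) ^ m p))
    ((summable_pi_succ_pow_mul_geometric E (fun _ => by norm_num)
      (fun _ => by norm_num)).mul_left K)
    (fun m => ?_) ?_
  · have : Continuous fun r : P → ℝ => seriesCoeff α β k s m * ∏ p, (r p : ℂ) ^ m p := by
      fun_prop
    exact this.tendsto 0
  · have h1 : ∀ᶠ r : P → ℝ in 𝓝 0, ∀ p, |r p| < 1 / 2 := by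
      refine eventually_all.mpr fun p => ?_
      have hc : ContinuousAt (fun r : P → ℝ => |r p|) 0 :=
        (continuous_apply p).abs.continuousAt
      exact hc.eventually (gt_mem_nhds (by simp))
    filter_upwards [h1] with r hr m
    rw [norm_mul, norm_prod_ofReal_pow, ← mul_assoc]
    have := hE m
    have h3 : ∏ p, |r p| ^ m p ≤ ∏ p : P, (1 / 2 : ℝ) ^ m p :=
      Finset.prod_le_prod (fun p _ => by positivity)
        fun p _ => pow_le_pow_left₀ (abs_nonneg _) (hr p).le _
    gcongr

/-! ### The integral over a product of loops -/

/-- The product of loops, in angular coordinates. -/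
def loopCube (V : Type*) : Set (V → ℝ) := Set.univ.pi fun _ => Set.Icc 0 (2 * Real.pi)

lemma restrict_loopCube : (volume : Measure (V → ℝ)).restrict (loopCube V) =
    Measure.pi fun _ => (volume : Measure ℝ).restrict (Set.Icc 0 (2 * Real.pi)) := by
  rw [volume_pi]
  exact Measure.restrict_pi_pi _ _

lemma integrable_loopIntegrand (a : ℂ) {s : ℂ} (hs : s.re < 1) :
    Integrable (loopIntegrand a s) (volume.restrict (Set.Icc 0 (2 * Real.pi))) :=
  (intervalIntegrable_iff_integrableOn_Icc_of_le (by positivity)).mp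
    (intervalIntegrable_loopIntegrand a hs)

lemma integral_Icc_loopIntegrand (a : ℂ) {s : ℂ} (hs : s.re < 1) :
    ∫ θ in Set.Icc 0 (2 * Real.pi), loopIntegrand a s θ = loopBeta a s := by
  rw [← loopIntegral_eq_loopBeta a hs, loopIntegral,
    intervalIntegral.integral_of_le (by positivity), integral_Icc_eq_integral_Ioc]

lemma integrableOn_prod_loopIntegrand (a : V → ℂ) {s : ℂ} (hs : s.re < 1) :
    IntegrableOn (fun θ : V → ℝ => ∏ v, loopIntegrand (a v) s (θ v)) (loopCube V) := by
  rw [IntegrableOn, restrict_loopCube]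
  exact Integrable.fintype_prod fun v => integrable_loopIntegrand (a v) hs

lemma integral_prod_loopIntegrand (a : V → ℂ) {s : ℂ} (hs : s.re < 1) :
    ∫ θ in loopCube V, ∏ v, loopIntegrand (a v) s (θ v) = ∏ v, loopBeta (a v) s := by
  rw [restrict_loopCube, integral_fintype_prod_eq_prod (fun v => loopIntegrand (a v) s)]
  exact Finset.prod_congr rfl fun v _ => integral_Icc_loopIntegrand _ hs

lemma norm_exp_I_mul_sum (k : V → ℤ) (θ : V → ℝ) : ‖exp (I * ∑ v, (k v : ℂ) * θ v)‖ = 1 := by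
  have : (∑ v, (k v : ℂ) * θ v) = ((∑ v, (k v : ℝ) * θ v : ℝ) : ℂ) := by push_cast; rfl
  rw [this, norm_exp_I_mul_ofReal]

lemma norm_ofReal_mul_exp_lt {r : ℝ} (hr : |r| < 1) (k : V → ℤ) (θ : V → ℝ) :
    ‖(r : ℂ) * exp (I * ∑ v, (k v : ℂ) * θ v)‖ < 1 := by
  rw [norm_mul, norm_exp_I_mul_sum, mul_one, norm_real]; exact hr

theorem integrableOn_modelIntegrand (α : V → ℂ) (β : P → ℂ) (k : P → V → ℤ) {r : P → ℝ}
    (hr : ∀ p, |r p| < 1) {s : ℂ} (hs : s.re < 1) :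
    IntegrableOn (modelIntegrand α β k r s) (loopCube V) := by
  refine (integrableOn_prod_loopIntegrand (fun v => s * α v) hs).mul_continuousOn ?_
    (isCompact_univ_pi fun _ => isCompact_Icc)
  refine Continuous.continuousOn (continuous_finsetProd _ fun p _ => ?_)
  refine Continuous.cpow (by fun_prop) continuous_const fun θ => ?_
  rw [sub_eq_add_neg]
  exact mem_slitPlane_of_norm_lt_one (by
    rw [norm_neg]; exact norm_ofReal_mul_exp_lt (hr p) (k p) θ)

lemma loopIntegrand_add_intCast (a s : ℂ) (n : ℤ) (θ : ℝ) :
    loopIntegrand (a + n) s θ = exp (I * (n * θ)) * loopIntegrand a s θ := by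
  unfold loopIntegrand
  rw [show I * (a + n) * θ = I * (n * θ) + I * a * θ by ring, exp_add]
  ring

lemma prod_loopIntegrand_add_totalWinding (a : V → ℂ) (k : P → V → ℤ) (s : ℂ) (m : P → ℕ)
    (θ : V → ℝ) :
    ∏ v, loopIntegrand (a v + (totalWinding k m v : ℂ)) s (θ v) =
      (∏ p, exp (I * ∑ v, (k p v : ℂ) * θ v) ^ m p) * ∏ v, loopIntegrand (a v) s (θ v) := by
  simp only [loopIntegrand_add_intCast, Finset.prod_mul_distrib]
  congr 1
  rw [← exp_sum]
  simp only [← exp_nat_mul]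
  rw [← exp_sum]
  congr 1
  simp only [totalWinding, Int.cast_sum, Int.cast_mul, Int.cast_natCast, Finset.mul_sum,
    Finset.sum_mul]
  rw [Finset.sum_comm]
  refine Finset.sum_congr rfl fun p _ => Finset.sum_congr rfl fun v _ => ?_
  ring

/-- The integral over the product of loops, obtained by expanding the regular factors into
binomial series. -/
theorem integral_modelIntegrand (α : V → ℂ) (β : P → ℂ) (k : P → V → ℤ) {r : P → ℝ}
    (hr : ∀ p, |r p| < 1) {s : ℂ} (hs : s.re < 1) :
    ∫ θ in loopCube V, modelIntegrand α β k r s θ = loopSeries α β k r s := by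
  set F : (P → ℕ) → (V → ℝ) → ℂ := fun m θ =>
    (∏ p, (binomCoeff (s * β p) (m p) * (r p : ℂ) ^ m p)) *
      ∏ v, loopIntegrand (s * α v + (totalWinding k m v : ℂ)) s (θ v) with hF
  have hsumm : ∀ x : P → ℂ, (∀ p, ‖x p‖ < 1) →
      ∀ p, Summable fun j : ℕ => ‖binomCoeff (s * β p) j * x p ^ j‖ := by
    intro x hx p
    obtain ⟨M, hM⟩ := exists_nat_ge ‖s * β p‖
    refine Summable.of_nonneg_of_le (fun _ => norm_nonneg _) (fun j => ?_)
      (summable_succ_pow_mul_geometric M (norm_nonneg (x p)) (hx p))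
    rw [norm_mul, norm_pow]
    have := norm_binomCoeff_le hM j
    gcongr
  have hsum : ∀ θ, HasSum (fun m => F m θ) (modelIntegrand α β k r s θ) := by
    intro θ
    have hx : ∀ p, ‖(r p : ℂ) * exp (I * ∑ v, (k p v : ℂ) * θ v)‖ < 1 := fun p =>
      norm_ofReal_mul_exp_lt (hr p) (k p) θ
    have h := (hasSum_pi_prod (fun p j => binomCoeff (s * β p) j *
      ((r p : ℂ) * exp (I * ∑ v, (k p v : ℂ) * θ v)) ^ j) (hsumm _ hx)).2.mul_left
      (∏ v, loopIntegrand (s * α v) s (θ v))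
    have e : ∀ p, ∑' j, binomCoeff (s * β p) j *
        ((r p : ℂ) * exp (I * ∑ v, (k p v : ℂ) * θ v)) ^ j =
        (1 - r p * exp (I * ∑ v, (k p v : ℂ) * θ v)) ^ (s * β p) := fun p =>
      (hasSum_one_sub_cpow (s * β p) (hx p)).tsum_eq
    simp only [e] at h
    refine h.congr_fun fun m => ?_
    simp only [hF, prod_loopIntegrand_add_totalWinding, mul_pow, Finset.prod_mul_distrib]
    ring
  have hint : ∀ m, Integrable (F m) (volume.restrict (loopCube V)) := fun m =>
    (integrableOn_prod_loopIntegrand _ hs).const_mul _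
  -- The exponentials in the expansion have modulus `1`, so all terms have the same integral norm
  -- up to the coefficient.
  have hnorm : ∀ m θ, ‖F m θ‖ = ‖∏ p, (binomCoeff (s * β p) (m p) * (r p : ℂ) ^ m p)‖ *
      ‖∏ v, loopIntegrand (s * α v) s (θ v)‖ := by
    intro m θ
    simp only [hF, prod_loopIntegrand_add_totalWinding, norm_mul]
    have h1 : ‖∏ p, exp (I * ∑ v, (k p v : ℂ) * θ v) ^ m p‖ = 1 := by
      rw [norm_prod]
      exact Finset.prod_eq_one fun p _ => by rw [norm_pow, norm_exp_I_mul_sum, one_pow]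
    rw [h1, one_mul]
  have hmain := hasSum_integral_of_summable_integral_norm hint (by
    simp only [hnorm, integral_const_mul]
    exact (hasSum_pi_prod _ (hsumm (fun p => (r p : ℂ))
      fun p => by rw [norm_real]; exact hr p)).1.mul_right _)
  have e1 : ∀ m, ∫ θ in loopCube V, F m θ = seriesCoeff α β k s m * ∏ p, (r p : ℂ) ^ m p := by
    intro m
    simp only [hF, integral_const_mul]
    rw [integral_prod_loopIntegrand _ hs, Finset.prod_mul_distrib, seriesCoeff]
    ring
  simp only [e1, (hsum _).tsum_eq] at hmain
  exact hmain.tsum_eq.symm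

end LoopSeries

/-! ### Pairings of weights -/

lemma dotProduct_simpleRoot {n : ℕ} (x : Fin (n + 1) → ℂ) (m : Fin n) :
    x ⬝ᵥ simpleRoot n m = x m.castSucc - x m.succ := by
  simp [simpleRoot, dotProduct_sub]

lemma simpleRoot_apply {n : ℕ} (a : Fin n) (i : Fin (n + 1)) :
    simpleRoot n a i = (if (i : ℕ) = a then 1 else 0) - (if (i : ℕ) = a + 1 then 1 else 0) := by
  simp [simpleRoot, Pi.single_apply, Fin.ext_iff]

lemma simpleRoot_dotProduct_of_lt {n : ℕ} {a b : Fin n} (h : a < b) :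
    simpleRoot n a ⬝ᵥ simpleRoot n b = if (b : ℕ) = a + 1 then -1 else 0 := by
  have h' : (a : ℕ) < b := h
  rw [dotProduct_simpleRoot, simpleRoot_apply, simpleRoot_apply]
  simp only [Fin.val_castSucc, Fin.val_succ]
  rw [if_neg (by omega), if_neg (show ¬ (b : ℕ) + 1 = a by omega),
    if_neg (show ¬ (b : ℕ) + 1 = a + 1 by omega)]
  split_ifs <;> simp

lemma Lambda1_apply (n : ℕ) (i : Fin (n + 1)) :
    Lambda1 n i = (if (i : ℕ) = 0 then 1 else 0) - 1 / ((n : ℂ) + 1) := by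
  simp only [Lambda1, Pi.sub_apply, Pi.single_apply, Fin.ext_iff, Fin.val_zero]

lemma Lambda1_dotProduct_simpleRoot {n : ℕ} (m : Fin n) :
    Lambda1 n ⬝ᵥ simpleRoot n m = if (m : ℕ) = 0 then 1 else 0 := by
  rw [dotProduct_simpleRoot, Lambda1_apply, Lambda1_apply, Fin.val_castSucc, Fin.val_succ,
    if_neg (show ¬ (m : ℕ) + 1 = 0 by omega)]
  ring

variable {n N : ℕ}

lemma sum_lt_eq_sum_fin {M : Type*} [AddCommMonoid M] {L : ℕ} (hL : L ≤ n) (f : Fin n → M) :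
    ∑ m : Fin n with m.val < L, f m = ∑ q : Fin L, f (Fin.castLE hL q) := by
  have h : (Finset.univ.filter fun m : Fin n => m.val < L) =
      Finset.univ.map (Fin.castLEEmb hL) := by
    ext m
    simp only [Finset.mem_filter, Finset.mem_univ, true_and, Finset.mem_map]
    exact ⟨fun hm => ⟨⟨m, hm⟩, rfl⟩, by rintro ⟨q, rfl⟩; exact q.isLt⟩
  rw [h, Finset.sum_map]
  rfl

lemma sum_roots_eq (c : Fin N → Fin (n + 1)) (j : Fin N) {M : Type*} [AddCommMonoid M]
    (f : Fin n → M) :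
    ∑ m : Fin n with m.val < (c j).val, f m = ∑ q : Fin (c j : ℕ), f (color c ⟨j, q⟩) :=
  sum_lt_eq_sum_fin (Nat.lt_succ_iff.mp (c j).isLt) f

lemma h_dotProduct_simpleRoot (c : Fin N → Fin (n + 1)) (k : Fin N) (m : Fin n) :
    h n (c k) ⬝ᵥ simpleRoot n m = (if (m : ℕ) = 0 then 1 else 0) -
      ∑ q : Fin (c k : ℕ), simpleRoot n (color c ⟨k, q⟩) ⬝ᵥ simpleRoot n m := by
  rw [h, sub_dotProduct, Lambda1_dotProduct_simpleRoot, sum_dotProduct, sum_roots_eq]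

/-! ### The windings of the variables -/

/-- The angles that enter the variable `v`: `log t_v = log z_j + i ∑_u winding v u * θ_u`. -/
def winding (c : Fin N → Fin (n + 1)) (v u : Var c) : ℤ :=
  if u.1 = v.1 ∧ (u.2 : ℕ) ≤ v.2 then 1 else 0

lemma sum_step {c : Fin N → Fin (n + 1)} {M : Type*} [AddCommMonoid M] (j : Fin N)
    (f : Var c → M) :
    ∑ u : Var c, (if u.1 = j then f u else 0) = ∑ q : Fin (c j : ℕ), f ⟨j, q⟩ := by
  rw [Fintype.sum_sigma, Finset.sum_eq_single j]
  · simp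
  · intro k _ hk
    simp [hk]
  · simp

lemma logT_eq (z : Fin N → ℝ) (c : Fin N → Fin (n + 1)) (θ : Var c → ℝ) (v : Var c) :
    logT z c θ v = (Real.log (z v.1) : ℂ) + I * ∑ u, (winding c v u : ℂ) * θ u := by
  unfold logT
  congr 2
  have h := sum_step v.1 fun u : Var c => if (u.2 : ℕ) ≤ v.2 then (θ u : ℂ) else 0
  rw [Finset.sum_filter]
  simp only [Fin.le_def]
  rw [← h]
  refine Finset.sum_congr rfl fun u _ => ?_
  unfold winding
  by_cases h1 : u.1 = v.1 <;> by_cases h2 : (u.2 : ℕ) ≤ v.2 <;> simp [h1, h2]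

lemma logT_of_first (z : Fin N → ℝ) {c : Fin N → Fin (n + 1)} (θ : Var c → ℝ) {v : Var c}
    (hv : (v.2 : ℕ) = 0) : logT z c θ v - (Real.log (z v.1) : ℂ) = I * θ v := by
  rw [logT_eq, add_sub_cancel_left, Finset.sum_eq_single v]
  · simp [winding]
  · intro u _ hu
    have : ¬ (u.1 = v.1 ∧ (u.2 : ℕ) ≤ v.2) := by
      rintro ⟨h1, h2⟩
      obtain ⟨j, q⟩ := v
      obtain ⟨j', q'⟩ := u
      simp only at h1 h2 hv
      subst h1
      exact hu (by congr 1; exact Fin.ext (by omega))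
    simp [winding, this]
  · simp

lemma logT_of_next (z : Fin N → ℝ) {c : Fin N → Fin (n + 1)} (θ : Var c → ℝ) {v w : Var c}
    (h1 : v.1 = w.1) (h2 : (w.2 : ℕ) = v.2 + 1) : logT z c θ w - logT z c θ v = I * θ w := by
  rw [logT_eq, logT_eq, h1, add_sub_add_left_eq_sub, ← mul_sub, ← Finset.sum_sub_distrib,
    Finset.sum_eq_single w]
  · simp [winding, h1, h2]
  · intro u _ hu
    rw [← sub_mul]
    have : winding c w u = winding c v u := by
      unfold winding
      by_cases h3 : u.1 = w.1
      · have h5 : u.1 = v.1 := h3.trans h1.symm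
        have h4 : (u.2 : ℕ) ≠ v.2 + 1 := by
          intro h4
          obtain ⟨j, q⟩ := w
          obtain ⟨j', q'⟩ := u
          simp only at h3 h2 h4
          subst h3
          exact hu (by congr 1; exact Fin.ext (by omega))
        by_cases h6 : (u.2 : ℕ) ≤ v.2
        · rw [if_pos ⟨h3, by omega⟩, if_pos ⟨h5, h6⟩]
        · rw [if_neg (fun h => by omega), if_neg (fun h => h6 h.2)]
      · rw [if_neg (fun h => h3 h.1), if_neg (fun h => h3 (h.1.trans h1))]
    rw [this, sub_self, zero_mul]
  · simp

/-! ### Splitting the integrand -/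

/-- The factors of the integrand between a point `z_j` and a variable, and between two
variables. -/
abbrev Factor (c : Fin N → Fin (n + 1)) : Type := (Fin N × Var c) ⊕ (Var c × Var c)

/-- The exponents, in units of `1/κ`, of the factors between different steps; the other factors
have exponent `0` here. -/
noncomputable def crossExponent (c : Fin N → Fin (n + 1)) : Factor c → ℂ
  | .inl (j, v) => if (v.2 : ℕ) = 0 ∧ v.1 ≠ j then -1 else 0
  | .inr (v, w) => if w.1 < v.1 then
      simpleRoot n (color c v) ⬝ᵥ simpleRoot n (color c w) else 0

/-- The ratio of the radii of the inner and the outer point of a factor between different steps. -/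
noncomputable def crossRatio (c : Fin N → Fin (n + 1)) (z : Fin N → ℝ) : Factor c → ℝ
  | .inl (j, v) => if v.1 < j then z v.1 / z j else if j < v.1 then z j / z v.1 else 0
  | .inr (v, w) => if w.1 < v.1 then z w.1 / z v.1 else 0

/-- The dependence of the quotient of the inner by the outer point on the angles. -/
def crossWinding (c : Fin N → Fin (n + 1)) : Factor c → Var c → ℤ
  | .inl (j, v) => fun u => if v.1 < j then winding c v u else -winding c v u
  | .inr (v, w) => fun u => winding c w u - winding c v u

lemma exp_log_div {x y : ℝ} (hx : 0 < x) (hy : 0 < y) (w : ℂ) :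
    exp ((Real.log x : ℂ) - Real.log y + w) = ((x / y : ℝ) : ℂ) * exp w := by
  rw [exp_add, ← ofReal_sub, ← Real.log_div hx.ne' hy.ne', ← ofReal_exp,
    Real.exp_log (div_pos hx hy)]

/-- What is left of a factor between different steps after the power of its outer point is taken
out; it is `1` for the other factors. -/
noncomputable def crossFactor (c : Fin N → Fin (n + 1)) (z : Fin N → ℝ) (s : ℂ) (θ : Var c → ℝ)
    (p : Factor c) : ℂ :=
  (1 - crossRatio c z p * exp (I * ∑ u, (crossWinding c p u : ℂ) * θ u)) ^
    (s * crossExponent c p)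

/-- A factor between `z_j` and a first variable is a power of its outer point, times a factor
between different steps, times the loop singularity if both belong to the same step. -/
lemma powSub_point_variable {z : Fin N → ℝ} (hz : ∀ j, 0 < z j) {c : Fin N → Fin (n + 1)}
    (κ : ℂ) (θ : Var c → ℝ) (j : Fin N) {v : Var c} (hv : (v.2 : ℕ) = 0) :
    (if v.1 ≤ j
      then powSub (Real.log (z j)) (logT z c θ v)
        ((Lambda1 n ⬝ᵥ (-simpleRoot n (color c v))) / κ)
      else powSub (logT z c θ v) (Real.log (z j))
        ((Lambda1 n ⬝ᵥ (-simpleRoot n (color c v))) / κ)) =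
    exp (1 / κ * -(if v.1 ≤ j then (Real.log (z j) : ℂ) else logT z c θ v)) *
      crossFactor c z (1 / κ) θ (.inl (j, v)) *
      (if v.1 = j then (1 - exp (I * θ v)) ^ (-(1 / κ)) else 1) := by
  have hL : Lambda1 n ⬝ᵥ (-simpleRoot n (color c v)) = -1 := by
    rw [dotProduct_neg, Lambda1_dotProduct_simpleRoot, if_pos (by simpa [color] using hv)]
  have e1 : ((-1 : ℂ)) / κ = 1 / κ * -1 := by ring
  have e2 : -(1 / κ) = 1 / κ * -1 := by ring
  rw [hL, e1, e2]
  unfold powSub crossFactor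
  rcases lt_trichotomy v.1 j with h | h | h
  · rw [if_pos h.le, if_pos h.le, if_neg h.ne]
    simp only [crossExponent, crossRatio, crossWinding, if_pos h, if_pos (And.intro hv h.ne)]
    rw [logT_eq, add_sub_right_comm, exp_log_div (hz _) (hz _)]
    ring_nf
  · subst h
    rw [if_pos le_rfl, if_pos le_rfl, if_pos rfl, logT_of_first z θ hv]
    simp only [crossExponent, ne_eq, not_true_eq_false, and_false, if_false, mul_zero, cpow_zero]
    ring_nf
  · rw [if_neg (not_le.mpr h), if_neg (not_le.mpr h), if_neg h.ne']
    simp only [crossExponent, crossRatio, crossWinding, if_pos h, if_neg h.not_gt,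
      if_pos (And.intro hv h.ne')]
    have e3 : (Real.log (z j) : ℂ) - logT z c θ v = Real.log (z j) - Real.log (z v.1) +
        I * ∑ u, ((-winding c v u : ℤ) : ℂ) * θ u := by
      rw [logT_eq]
      simp only [Int.cast_neg, neg_mul, Finset.sum_neg_distrib]
      ring
    rw [e3, exp_log_div (hz _) (hz _)]
    ring_nf

lemma powSub_variable_variable {z : Fin N → ℝ} (hz : ∀ j, 0 < z j) {c : Fin N → Fin (n + 1)}
    (κ : ℂ) (θ : Var c → ℝ) {v w : Var c} (hvw : Outside c v w) :
    powSub (logT z c θ v) (logT z c θ w)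
      ((simpleRoot n (color c v) ⬝ᵥ simpleRoot n (color c w)) / κ) =
    exp (1 / κ * ((simpleRoot n (color c v) ⬝ᵥ simpleRoot n (color c w)) * logT z c θ v)) *
      crossFactor c z (1 / κ) θ (.inr (v, w)) *
      (if v.1 = w.1 ∧ (w.2 : ℕ) = v.2 + 1 then (1 - exp (I * θ w)) ^ (-(1 / κ)) else 1) := by
  unfold powSub crossFactor
  rcases hvw with h | ⟨h1, h2⟩
  · rw [if_neg (fun h' => h.ne' h'.1)]
    simp only [crossExponent, crossRatio, crossWinding, if_pos h]
    have e3 : logT z c θ w - logT z c θ v = Real.log (z w.1) - Real.log (z v.1) +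
        I * ∑ u, ((winding c w u - winding c v u : ℤ) : ℂ) * θ u := by
      rw [logT_eq, logT_eq]
      simp only [Int.cast_sub, sub_mul, Finset.sum_sub_distrib]
      ring
    rw [e3, exp_log_div (hz _) (hz _)]
    ring_nf
  · have hlt : color c v < color c w := h2
    have hx : crossExponent c (.inr (v, w)) = 0 := by
      simp [crossExponent, h1]
    rw [hx, mul_zero, cpow_zero, simpleRoot_dotProduct_of_lt hlt]
    have hcol : ((color c w : ℕ) = color c v + 1) ↔ ((w.2 : ℕ) = v.2 + 1) := Iff.rfl
    by_cases h3 : (w.2 : ℕ) = v.2 + 1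
    · rw [if_pos (hcol.mpr h3), if_pos ⟨h1, h3⟩, logT_of_next z θ h1 h3]
      ring_nf
    · rw [if_neg (fun h' => h3 (hcol.mp h')), if_neg (fun h' => h3 h'.2)]
      simp

/-! ### Collecting the exponents -/

/-- The exponent of `e^{iθ_u}` in the integrand, in units of `1/κ`: with `p` the number of roots
from the variable `u` to the end of its step, it is `κ A_p - (p - 1)`. -/
noncomputable def loopExponent (lam : Fin (n + 1) → ℂ) (c : Fin N → Fin (n + 1)) (u : Var c) : ℂ :=
  weightBefore lam c u.1 ⬝ᵥ negTail c u.1 ((c u.1 : ℕ) - u.2) -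
    (((c u.1 : ℕ) : ℂ) - ((u.2 : ℕ) : ℂ)) + 1

/-- The exponent of the variable `t_v` in the integrand, in units of `1/κ`, when each difference
is replaced by its outer point and the points `z_j` outside `t_v` are disregarded. -/
noncomputable def outerExponent (lam : Fin (n + 1) → ℂ) (c : Fin N → Fin (n + 1)) (v : Var c) : ℂ :=
  lam ⬝ᵥ (-simpleRoot n (color c v)) - (if (v.2 : ℕ) = 0 then ((v.1 : ℕ) : ℂ) else 0) +
    ∑ w : Var c, if Outside c v w then
      simpleRoot n (color c v) ⬝ᵥ simpleRoot n (color c w) else 0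

lemma sum_same_step (c : Fin N → Fin (n + 1)) (v : Var c) :
    (∑ q : Fin (c v.1 : ℕ), if (v.2 : ℕ) < q then
      simpleRoot n (color c v) ⬝ᵥ simpleRoot n (color c ⟨v.1, q⟩) else 0) =
    -(if (v.2 : ℕ) + 1 < (c v.1 : ℕ) then (1 : ℂ) else 0) := by
  have e : ∀ q : Fin (c v.1 : ℕ), (if (v.2 : ℕ) < q then
      simpleRoot n (color c v) ⬝ᵥ simpleRoot n (color c ⟨v.1, q⟩) else 0) =
      if (q : ℕ) = v.2 + 1 then (-1 : ℂ) else 0 := by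
    intro q
    by_cases h : (v.2 : ℕ) < q
    · rw [if_pos h, simpleRoot_dotProduct_of_lt (show color c v < color c ⟨v.1, q⟩ from h)]
      rfl
    · rw [if_neg h, if_neg (by omega)]
  simp only [e]
  by_cases h : (v.2 : ℕ) + 1 < (c v.1 : ℕ)
  · rw [if_pos h, Finset.sum_eq_single ⟨(v.2 : ℕ) + 1, h⟩]
    · simp
    · intro q _ hq
      rw [if_neg (fun h' => hq (Fin.ext h'))]
    · simp
  · rw [if_neg h, neg_zero]
    exact Finset.sum_eq_zero fun q _ => if_neg (fun h' => by have := q.isLt; omega)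

lemma sum_outside (c : Fin N → Fin (n + 1)) (v : Var c) :
    (∑ w : Var c, if Outside c v w then
      simpleRoot n (color c v) ⬝ᵥ simpleRoot n (color c w) else 0) =
    (∑ k : Fin N with k < v.1, ∑ q : Fin (c k : ℕ),
      simpleRoot n (color c ⟨k, q⟩) ⬝ᵥ simpleRoot n (color c v)) -
    (if (v.2 : ℕ) + 1 < (c v.1 : ℕ) then (1 : ℂ) else 0) := by
  have e : ∀ w : Var c, (if Outside c v w then
      simpleRoot n (color c v) ⬝ᵥ simpleRoot n (color c w) else 0) =
      (if w.1 < v.1 then simpleRoot n (color c w) ⬝ᵥ simpleRoot n (color c v) else 0) +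
      (if w.1 = v.1 then (if (v.2 : ℕ) < w.2 then
        simpleRoot n (color c v) ⬝ᵥ simpleRoot n (color c w) else 0) else 0) := by
    intro w
    unfold Outside
    rcases lt_trichotomy w.1 v.1 with h | h | h
    · simp [h, h.ne, dotProduct_comm]
    · simp [h]
    · simp [h.ne', h.ne, h.not_gt]
  simp only [e, Finset.sum_add_distrib]
  rw [sum_step v.1 fun w => if (v.2 : ℕ) < w.2 then
    simpleRoot n (color c v) ⬝ᵥ simpleRoot n (color c w) else 0, sum_same_step, ← sub_eq_add_neg,
    Fintype.sum_sigma, Finset.sum_filter]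
  congr 1
  refine Finset.sum_congr rfl fun k _ => ?_
  by_cases h : k < v.1 <;> simp [h]

lemma card_filter_lt (j : Fin N) : (Finset.univ.filter fun k : Fin N => k < j).card = (j : ℕ) := by
  rw [← Fin.card_Iio]
  congr 1
  ext k
  simp

lemma outerExponent_eq (lam : Fin (n + 1) → ℂ) (c : Fin N → Fin (n + 1)) (v : Var c) :
    outerExponent lam c v = weightBefore lam c v.1 ⬝ᵥ (-simpleRoot n (color c v)) -
      (if (v.2 : ℕ) + 1 < (c v.1 : ℕ) then (1 : ℂ) else 0) := by
  rw [outerExponent, sum_outside, weightBefore, shiftBefore, dotProduct_neg, dotProduct_neg,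
    add_dotProduct, sum_dotProduct]
  simp only [h_dotProduct_simpleRoot, Finset.sum_sub_distrib, Finset.sum_const, card_filter_lt]
  have : ((color c v : Fin n) : ℕ) = (v.2 : ℕ) := rfl
  rw [this]
  by_cases h : (v.2 : ℕ) = 0
  · simp only [h, if_true, nsmul_eq_mul, mul_one]; ring
  · simp only [h, if_false, nsmul_eq_mul, mul_zero]; ring

lemma sum_count_tail {L : ℕ} (q₀ : Fin L) :
    (∑ q : Fin L, if q₀ ≤ q then (if (q : ℕ) + 1 < L then (1 : ℂ) else 0) else 0) =
      (L : ℂ) - ((q₀ : ℕ) : ℂ) - 1 := by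
  have e : ∀ q : Fin L, (if q₀ ≤ q then (if (q : ℕ) + 1 < L then (1 : ℂ) else 0) else 0) =
      (fun i : ℕ => if (q₀ : ℕ) ≤ i ∧ i + 1 < L then (1 : ℂ) else 0) q := by
    intro q
    simp only [Fin.le_def, ite_and]
  simp only [e]
  rw [Fin.sum_univ_eq_sum_range (fun i : ℕ => if (q₀ : ℕ) ≤ i ∧ i + 1 < L then (1 : ℂ) else 0),
    Finset.sum_boole]
  have h : (Finset.range L).filter (fun i : ℕ => (q₀ : ℕ) ≤ i ∧ i + 1 < L) =
      Finset.Ico (q₀ : ℕ) (L - 1) := by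
    ext i
    simp only [Finset.mem_filter, Finset.mem_range, Finset.mem_Ico]
    omega
  have hq := q₀.isLt
  rw [h, Nat.card_Ico, Nat.cast_sub (by omega), Nat.cast_sub (by omega)]
  push_cast
  ring

lemma sum_count_first (L : ℕ) :
    (∑ q : Fin L, if (q : ℕ) = 0 then (1 : ℂ) else 0) = if 0 < L then 1 else 0 := by
  cases L with
  | zero => simp
  | succ L => rw [Fin.sum_univ_succ]; simp

lemma negTail_eq (c : Fin N → Fin (n + 1)) (j : Fin N) (q₀ : Fin (c j : ℕ)) :
    negTail c j ((c j : ℕ) - q₀) =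
      ∑ q : Fin (c j : ℕ), if q₀ ≤ q then -simpleRoot n (color c ⟨j, q⟩) else 0 := by
  have h := sum_roots_eq c j fun m : Fin n =>
    if (q₀ : ℕ) ≤ m.val then -simpleRoot n m else 0
  rw [← Finset.sum_filter, Finset.filter_filter] at h
  rw [negTail]
  refine Eq.trans ?_ h
  refine Finset.sum_congr (Finset.filter_congr fun m _ => ?_) fun _ _ => rfl
  have := q₀.isLt
  omega

lemma sum_outerExponent_tail (lam : Fin (n + 1) → ℂ) (c : Fin N → Fin (n + 1)) (u : Var c) :
    ∑ v : Var c, outerExponent lam c v * (winding c v u : ℂ) = loopExponent lam c u := by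
  have e : ∀ v : Var c, outerExponent lam c v * (winding c v u : ℂ) =
      if v.1 = u.1 then (if (u.2 : ℕ) ≤ v.2 then outerExponent lam c v else 0) else 0 := by
    intro v
    unfold winding
    by_cases h1 : u.1 = v.1
    · by_cases h2 : (u.2 : ℕ) ≤ v.2
      · rw [if_pos ⟨h1, h2⟩, if_pos h1.symm, if_pos h2, Int.cast_one, mul_one]
      · rw [if_neg (fun h => h2 h.2), if_pos h1.symm, if_neg h2, Int.cast_zero, mul_zero]
    · rw [if_neg (fun h => h1 h.1), if_neg (fun h => h1 h.symm), Int.cast_zero, mul_zero]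
  simp only [e]
  rw [sum_step u.1 fun v : Var c => if (u.2 : ℕ) ≤ v.2 then outerExponent lam c v else 0,
    loopExponent, negTail_eq, dotProduct_sum]
  have h := sum_count_tail u.2
  have e2 : ∀ q : Fin (c u.1 : ℕ), (if (u.2 : ℕ) ≤ q then outerExponent lam c ⟨u.1, q⟩ else 0) =
      (weightBefore lam c u.1 ⬝ᵥ
        if u.2 ≤ q then -simpleRoot n (color c ⟨u.1, q⟩) else 0) -
      (if u.2 ≤ q then (if (q : ℕ) + 1 < (c u.1 : ℕ) then (1 : ℂ) else 0) else 0) := by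
    intro q
    by_cases hq : (u.2 : ℕ) ≤ q
    · rw [if_pos hq, if_pos (Fin.le_def.mpr hq), if_pos (Fin.le_def.mpr hq), outerExponent_eq]
    · rw [if_neg hq, if_neg (fun h => hq (Fin.le_def.mp h)),
        if_neg (fun h => hq (Fin.le_def.mp h)), dotProduct_zero, sub_zero]
  rw [Finset.sum_congr rfl fun q _ => e2 q, Finset.sum_sub_distrib, h]
  ring

/-- The numerator of `μ_j`. -/
noncomputable def muNumerator (lam : Fin (n + 1) → ℂ) (c : Fin N → Fin (n + 1)) (j : Fin N) : ℂ :=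
  (weightBefore lam c j ⬝ᵥ ∑ m : Fin n with m.val < (c j).val, -simpleRoot n m)
    - ((c j : ℕ) : ℂ)
    + ((shiftBefore c j - ((j : ℕ) : ℂ) • Lambda1 n) ⬝ᵥ Lambda1 n)

lemma h_dotProduct_Lambda1 (c : Fin N → Fin (n + 1)) (k : Fin N) :
    h n (c k) ⬝ᵥ Lambda1 n = Lambda1 n ⬝ᵥ Lambda1 n - if 0 < (c k : ℕ) then 1 else 0 := by
  rw [h, sub_dotProduct, sum_dotProduct, sum_roots_eq, ← sum_count_first]
  congr 1
  refine Finset.sum_congr rfl fun q _ => ?_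
  rw [dotProduct_comm, Lambda1_dotProduct_simpleRoot]
  rfl

lemma shiftBefore_sub_dotProduct (c : Fin N → Fin (n + 1)) (j : Fin N) :
    (shiftBefore c j - ((j : ℕ) : ℂ) • Lambda1 n) ⬝ᵥ Lambda1 n =
      -∑ k : Fin N with k < j, if 0 < (c k : ℕ) then (1 : ℂ) else 0 := by
  rw [sub_dotProduct, shiftBefore, sum_dotProduct]
  simp only [h_dotProduct_Lambda1, Finset.sum_sub_distrib, Finset.sum_const, card_filter_lt,
    smul_dotProduct, nsmul_eq_mul, smul_eq_mul]
  ring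

lemma sum_first_variables (c : Fin N → Fin (n + 1)) (j : Fin N) :
    (∑ v : Var c, if (v.2 : ℕ) = 0 ∧ v.1 ≤ j then (1 : ℂ) else 0) =
      (∑ k : Fin N with k < j, if 0 < (c k : ℕ) then (1 : ℂ) else 0) +
        if 0 < (c j : ℕ) then (1 : ℂ) else 0 := by
  rw [Fintype.sum_sigma]
  have e : ∀ k : Fin N, (∑ q : Fin (c k : ℕ), if (q : ℕ) = 0 ∧ k ≤ j then (1 : ℂ) else 0) =
      (if k < j then (if 0 < (c k : ℕ) then (1 : ℂ) else 0) else 0) +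
      (if k = j then (if 0 < (c k : ℕ) then (1 : ℂ) else 0) else 0) := by
    intro k
    rw [← sum_count_first]
    rcases lt_trichotomy k j with h | h | h
    · simp [h.le, h, h.ne]
    · simp [h]
    · simp [h.not_ge, h.not_gt, h.ne']
  simp only [e, Finset.sum_add_distrib]
  rw [Finset.sum_filter, Finset.sum_ite_eq' Finset.univ j]
  simp

lemma sum_outerExponent_step (lam : Fin (n + 1) → ℂ) (c : Fin N → Fin (n + 1)) (j : Fin N) :
    ∑ q : Fin (c j : ℕ), outerExponent lam c ⟨j, q⟩ -
      (∑ v : Var c, if (v.2 : ℕ) = 0 ∧ v.1 ≤ j then (1 : ℂ) else 0) = muNumerator lam c j := by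
  have e : ∀ L : ℕ, (∑ q : Fin L, if (q : ℕ) + 1 < L then (1 : ℂ) else 0) +
      (if 0 < L then 1 else 0) = L := by
    intro L
    cases L with
    | zero => simp
    | succ L =>
      have := sum_count_tail (0 : Fin (L + 1))
      simp only [Fin.zero_le, if_true] at this
      rw [this]
      simp
  rw [sum_first_variables, muNumerator, shiftBefore_sub_dotProduct, sum_roots_eq, dotProduct_sum]
  simp only [outerExponent_eq, Finset.sum_sub_distrib]
  linear_combination -(e (c j : ℕ))

/-- The exponents of all outer points together give `z^μ` and the exponents of the loops. -/
lemma total_exponent (lam : Fin (n + 1) → ℂ) (c : Fin N → Fin (n + 1)) (z : Fin N → ℝ)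
    (θ : Var c → ℝ) :
    (∑ v : Var c, (lam ⬝ᵥ (-simpleRoot n (color c v))) * logT z c θ v) +
    (∑ j : Fin N, ∑ v : Var c, if (v.2 : ℕ) = 0 then
      -(if v.1 ≤ j then (Real.log (z j) : ℂ) else logT z c θ v) else 0) +
    (∑ v : Var c, ∑ w : Var c, if Outside c v w then
      (simpleRoot n (color c v) ⬝ᵥ simpleRoot n (color c w)) * logT z c θ v else 0) =
    (∑ j, muNumerator lam c j * Real.log (z j)) + I * ∑ u, loopExponent lam c u * θ u := by
  have h2 : (∑ j : Fin N, ∑ v : Var c, if (v.2 : ℕ) = 0 then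
      -(if v.1 ≤ j then (Real.log (z j) : ℂ) else logT z c θ v) else 0) =
      -(∑ j : Fin N, (∑ v : Var c, if (v.2 : ℕ) = 0 ∧ v.1 ≤ j then (1 : ℂ) else 0) *
        Real.log (z j)) -
      ∑ v : Var c, (if (v.2 : ℕ) = 0 then ((v.1 : ℕ) : ℂ) else 0) * logT z c θ v := by
    have e : ∀ (j : Fin N) (v : Var c), (if (v.2 : ℕ) = 0 then
        -(if v.1 ≤ j then (Real.log (z j) : ℂ) else logT z c θ v) else 0) =
        -((if (v.2 : ℕ) = 0 ∧ v.1 ≤ j then (1 : ℂ) else 0) * Real.log (z j)) -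
        (if j < v.1 then (if (v.2 : ℕ) = 0 then logT z c θ v else 0) else 0) := by
      intro j v
      by_cases h : (v.2 : ℕ) = 0
      · rcases le_or_gt v.1 j with h' | h'
        · simp [h, h', h'.not_gt]
        · simp [h, h', h'.not_ge]
      · simp [h]
    simp only [e, Finset.sum_sub_distrib, Finset.sum_neg_distrib, ← Finset.sum_mul]
    congr 1
    rw [Finset.sum_comm]
    refine Finset.sum_congr rfl fun v _ => ?_
    rw [← Finset.sum_filter, Finset.sum_const, card_filter_lt, nsmul_eq_mul]
    by_cases h : (v.2 : ℕ) = 0 <;> simp [h]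
  have h3 : ∀ v : Var c, (∑ w : Var c, if Outside c v w then
      (simpleRoot n (color c v) ⬝ᵥ simpleRoot n (color c w)) * logT z c θ v else 0) =
      (∑ w : Var c, if Outside c v w then
        simpleRoot n (color c v) ⬝ᵥ simpleRoot n (color c w) else 0) * logT z c θ v := by
    intro v
    rw [Finset.sum_mul]
    refine Finset.sum_congr rfl fun w _ => ?_
    rw [ite_mul, zero_mul]
  have h4 : ∑ v : Var c, outerExponent lam c v * logT z c θ v =
      (∑ j, (∑ q : Fin (c j : ℕ), outerExponent lam c ⟨j, q⟩) * (Real.log (z j) : ℂ)) +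
        I * ∑ u, loopExponent lam c u * θ u := by
    simp only [logT_eq, mul_add, Finset.sum_add_distrib]
    congr 1
    · rw [Fintype.sum_sigma]
      simp only [Finset.sum_mul]
    · simp only [← sum_outerExponent_tail, Finset.mul_sum, Finset.sum_mul]
      rw [Finset.sum_comm]
      refine Finset.sum_congr rfl fun u _ => Finset.sum_congr rfl fun v _ => ?_
      ring
  have h5 : ∀ v : Var c, outerExponent lam c v * logT z c θ v =
      (lam ⬝ᵥ (-simpleRoot n (color c v))) * logT z c θ v -
      (if (v.2 : ℕ) = 0 then ((v.1 : ℕ) : ℂ) else 0) * logT z c θ v +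
      (∑ w : Var c, if Outside c v w then
        simpleRoot n (color c v) ⬝ᵥ simpleRoot n (color c w) else 0) * logT z c θ v := by
    intro v
    rw [outerExponent]
    ring
  simp only [h5, Finset.sum_add_distrib, Finset.sum_sub_distrib] at h4
  have h6 : ∀ j, muNumerator lam c j * (Real.log (z j) : ℂ) =
      (∑ q : Fin (c j : ℕ), outerExponent lam c ⟨j, q⟩) * (Real.log (z j) : ℂ) -
      (∑ v : Var c, if (v.2 : ℕ) = 0 ∧ v.1 ≤ j then (1 : ℂ) else 0) * Real.log (z j) := by
    intro j
    rw [← sum_outerExponent_step]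
    ring
  simp only [h6, Finset.sum_sub_distrib]
  simp only [h3, h2]
  linear_combination h4

/-! ### The integrand as a model integrand -/

lemma crossFactor_of_exponent_zero {c : Fin N → Fin (n + 1)} (z : Fin N → ℝ) (s : ℂ)
    (θ : Var c → ℝ) {p : Factor c} (hp : crossExponent c p = 0) : crossFactor c z s θ p = 1 := by
  rw [crossFactor, hp, mul_zero, cpow_zero]

/-- Each angle carries one loop singularity: that of a first variable comes from the factor with
`z_j`, that of any other variable from the factor with its predecessor. -/
lemma prod_loop_singularities {c : Fin N → Fin (n + 1)} (g : Var c → ℂ) :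
    (∏ j : Fin N, ∏ v : Var c, if (v.2 : ℕ) = 0 ∧ v.1 = j then g v else 1) *
      (∏ x : Var c × Var c, if x.1.1 = x.2.1 ∧ (x.2.2 : ℕ) = x.1.2 + 1 then g x.2 else 1) =
    ∏ v, g v := by
  have h1 : (∏ j : Fin N, ∏ v : Var c, if (v.2 : ℕ) = 0 ∧ v.1 = j then g v else 1) =
      ∏ v : Var c, if (v.2 : ℕ) = 0 then g v else 1 := by
    rw [Finset.prod_comm]
    refine Finset.prod_congr rfl fun v _ => ?_
    rw [Finset.prod_eq_single v.1]
    · simp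
    · intro j _ hj
      rw [if_neg (fun h => hj h.2.symm)]
    · simp
  have h2 : (∏ x : Var c × Var c,
      if x.1.1 = x.2.1 ∧ (x.2.2 : ℕ) = x.1.2 + 1 then g x.2 else 1) =
      ∏ w : Var c, if (w.2 : ℕ) = 0 then 1 else g w := by
    rw [Fintype.prod_prod_type_right]
    refine Finset.prod_congr rfl fun w _ => ?_
    by_cases hw : (w.2 : ℕ) = 0
    · rw [if_pos hw]
      exact Finset.prod_eq_one fun v _ => if_neg (fun h => by have := h.2; simp only at this; omega)
    · rw [if_neg hw, Finset.prod_eq_single ⟨w.1, ⟨(w.2 : ℕ) - 1, by omega⟩⟩]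
      · exact if_pos ⟨rfl, by simp only; omega⟩
      · rintro ⟨j, q⟩ _ hv
        refine if_neg ?_
        rintro ⟨h, h'⟩
        simp only at h h'
        subst h
        exact hv (by congr 1; exact Fin.ext (by simp only; omega))
      · simp
  rw [h1, h2, ← Finset.prod_mul_distrib]
  refine Finset.prod_congr rfl fun v _ => ?_
  split_ifs <;> simp

lemma monomial_eq_exp (μ : Fin N → ℂ) {z : Fin N → ℝ} (hz : ∀ j, 0 < z j) :
    monomial μ z = exp (∑ j, μ j * Real.log (z j)) := by
  rw [monomial, exp_sum]
  refine Finset.prod_congr rfl fun j _ => ?_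
  rw [cpow_def_of_ne_zero (by exact_mod_cast (hz j).ne'), ← ofReal_log (hz j).le, mul_comm]

theorem integrand_eq (lam : Fin (n + 1) → ℂ) (κ : ℂ) (c : Fin N → Fin (n + 1)) {z : Fin N → ℝ}
    (hz : ∀ j, 0 < z j) (θ : Var c → ℝ) :
    integrand lam κ c z θ = monomial (mu lam κ c) z * I ^ Fintype.card (Var c) *
      modelIntegrand (loopExponent lam c) (crossExponent c) (crossWinding c) (crossRatio c z)
        (1 / κ) θ := by
  set g : Var c → ℂ := fun v => (1 - exp (I * θ v)) ^ (-(1 / κ)) with hg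
  have e1 : (∏ v : Var c, exp ((lam ⬝ᵥ (-simpleRoot n (color c v))) / κ * logT z c θ v)) =
      exp (1 / κ * ∑ v : Var c, (lam ⬝ᵥ (-simpleRoot n (color c v))) * logT z c θ v) := by
    rw [← exp_sum, Finset.mul_sum]
    congr 1
    exact Finset.sum_congr rfl fun v _ => by ring
  have e2 : (∏ j : Fin N, ∏ v : Var c with (v.2 : ℕ) = 0,
      if v.1 ≤ j
      then powSub (Real.log (z j)) (logT z c θ v)
        ((Lambda1 n ⬝ᵥ (-simpleRoot n (color c v))) / κ)
      else powSub (logT z c θ v) (Real.log (z j))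
        ((Lambda1 n ⬝ᵥ (-simpleRoot n (color c v))) / κ)) =
      exp (1 / κ * ∑ j : Fin N, ∑ v : Var c, if (v.2 : ℕ) = 0 then
        -(if v.1 ≤ j then (Real.log (z j) : ℂ) else logT z c θ v) else 0) *
      (∏ x : Fin N × Var c, crossFactor c z (1 / κ) θ (.inl x)) *
      ∏ j : Fin N, ∏ v : Var c, if (v.2 : ℕ) = 0 ∧ v.1 = j then g v else 1 := by
    simp only [Finset.mul_sum, exp_sum, Fintype.prod_prod_type, ← Finset.prod_mul_distrib,
      Finset.prod_filter]
    refine Finset.prod_congr rfl fun j _ => Finset.prod_congr rfl fun v _ => ?_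
    by_cases hv : (v.2 : ℕ) = 0
    · simp only [powSub_point_variable hz κ θ j hv, hv, true_and, if_true, hg]
    · have h2 : crossExponent c (.inl (j, v)) = 0 := if_neg (fun h => hv h.1)
      simp only [hv, false_and, if_false, crossFactor_of_exponent_zero z _ θ h2,
        mul_zero, exp_zero, mul_one]
  have e3 : (∏ x : Var c × Var c with Outside c x.1 x.2,
      powSub (logT z c θ x.1) (logT z c θ x.2)
        ((simpleRoot n (color c x.1) ⬝ᵥ simpleRoot n (color c x.2)) / κ)) =
      exp (1 / κ * ∑ v : Var c, ∑ w : Var c, if Outside c v w then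
        (simpleRoot n (color c v) ⬝ᵥ simpleRoot n (color c w)) * logT z c θ v else 0) *
      (∏ x : Var c × Var c, crossFactor c z (1 / κ) θ (.inr x)) *
      ∏ x : Var c × Var c,
        if x.1.1 = x.2.1 ∧ (x.2.2 : ℕ) = x.1.2 + 1 then g x.2 else 1 := by
    rw [← Fintype.sum_prod_type' (fun v w : Var c => if Outside c v w then
        (simpleRoot n (color c v) ⬝ᵥ simpleRoot n (color c w)) * logT z c θ v else 0),
      Finset.mul_sum, exp_sum, Finset.prod_filter, ← Finset.prod_mul_distrib,
      ← Finset.prod_mul_distrib]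
    refine Finset.prod_congr rfl fun x _ => ?_
    obtain ⟨v, w⟩ := x
    by_cases hvw : Outside c v w
    · simp only [if_pos hvw, powSub_variable_variable hz κ θ hvw, hg]
    · have h1 : ¬ (v.1 = w.1 ∧ (w.2 : ℕ) = v.2 + 1) := fun h => hvw (Or.inr ⟨h.1, by omega⟩)
      have h2 : crossExponent c (.inr (v, w)) = 0 := if_neg (fun h => hvw (Or.inl h))
      simp only [if_neg hvw, if_neg h1, crossFactor_of_exponent_zero z _ θ h2, mul_zero, exp_zero,
        mul_one]
  have e4 : modelIntegrand (loopExponent lam c) (crossExponent c) (crossWinding c)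
      (crossRatio c z) (1 / κ) θ =
      exp (1 / κ * (I * ∑ u, loopExponent lam c u * θ u)) * (∏ v, g v) *
      ((∏ x : Fin N × Var c, crossFactor c z (1 / κ) θ (.inl x)) *
      ∏ x : Var c × Var c, crossFactor c z (1 / κ) θ (.inr x)) := by
    rw [← Fintype.prod_sum_type, modelIntegrand]
    congr 1
    unfold loopIntegrand
    rw [Finset.prod_mul_distrib, ← exp_sum]
    congr 2
    rw [Finset.mul_sum, Finset.mul_sum]
    exact Finset.sum_congr rfl fun v _ => by ring
  have e5 : monomial (mu lam κ c) z =
      exp (1 / κ * ∑ j, muNumerator lam c j * Real.log (z j)) := by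
    rw [monomial_eq_exp _ hz, Finset.mul_sum]
    congr 1
    refine Finset.sum_congr rfl fun j _ => ?_
    rw [mu, ← muNumerator]
    ring
  have e6 : exp (1 / κ * ∑ v : Var c, (lam ⬝ᵥ (-simpleRoot n (color c v))) * logT z c θ v) *
      exp (1 / κ * ∑ j : Fin N, ∑ v : Var c, if (v.2 : ℕ) = 0 then
        -(if v.1 ≤ j then (Real.log (z j) : ℂ) else logT z c θ v) else 0) *
      exp (1 / κ * ∑ v : Var c, ∑ w : Var c, if Outside c v w then
        (simpleRoot n (color c v) ⬝ᵥ simpleRoot n (color c w)) * logT z c θ v else 0) =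
      exp (1 / κ * ∑ j, muNumerator lam c j * Real.log (z j)) *
        exp (1 / κ * (I * ∑ u, loopExponent lam c u * θ u)) := by
    rw [← exp_add, ← exp_add, ← exp_add, ← mul_add, ← mul_add, ← mul_add, total_exponent]
  rw [integrand, e1, e2, e3, e4, e5, ← prod_loop_singularities g]
  linear_combination ((∏ j : Fin N, ∏ v : Var c, if (v.2 : ℕ) = 0 ∧ v.1 = j then g v else 1) *
      (∏ x : Var c × Var c, if x.1.1 = x.2.1 ∧ (x.2.2 : ℕ) = x.1.2 + 1 then g x.2 else 1) *
      ((∏ x : Fin N × Var c, crossFactor c z (1 / κ) θ (.inl x)) *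
      ∏ x : Var c × Var c, crossFactor c z (1 / κ) θ (.inr x)) *
      I ^ Fintype.card (Var c)) * e6

/-! ### The continued integral and its asymptotics -/

/-- The integral over the cycle, continued to all regular `κ`. -/
noncomputable def blockIntegral (lam : Fin (n + 1) → ℂ) (c : Fin N → Fin (n + 1)) (z : Fin N → ℝ)
    (κ : ℂ) : ℂ :=
  monomial (mu lam κ c) z * I ^ Fintype.card (Var c) *
    loopSeries (loopExponent lam c) (crossExponent c) (crossWinding c) (crossRatio c z) (1 / κ)

lemma abs_crossRatio_lt_one (c : Fin N → Fin (n + 1)) {z : Fin N → ℝ} (hz : z ∈ chamber N)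
    (p : Factor c) : |crossRatio c z p| < 1 := by
  have key : ∀ i j : Fin N, i < j → |z i / z j| < 1 := by
    intro i j hij
    rw [abs_of_pos (div_pos (hz.1 i) (hz.1 j)), div_lt_one (hz.1 j)]
    exact hz.2 hij
  rcases p with ⟨j, v⟩ | ⟨v, w⟩ <;> simp only [crossRatio]
  · split_ifs with h1 h2
    exacts [key _ _ h1, key _ _ h2, by simp]
  · split_ifs with h1
    exacts [key _ _ h1, by simp]

lemma integrableOn_integrand (lam : Fin (n + 1) → ℂ) (c : Fin N → Fin (n + 1)) {z : Fin N → ℝ}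
    (hz : z ∈ chamber N) {κ : ℂ} (hκ : (1 / κ).re < 1) :
    IntegrableOn (integrand lam κ c z) (cube c) := by
  have h : integrand lam κ c z = fun θ => monomial (mu lam κ c) z * I ^ Fintype.card (Var c) *
      modelIntegrand (loopExponent lam c) (crossExponent c) (crossWinding c) (crossRatio c z)
        (1 / κ) θ := funext fun θ => integrand_eq lam κ c hz.1 θ
  rw [h]
  exact (integrableOn_modelIntegrand _ _ _ (abs_crossRatio_lt_one c hz) hκ).const_mul _

lemma cycleIntegral_eq (lam : Fin (n + 1) → ℂ) (c : Fin N → Fin (n + 1)) {z : Fin N → ℝ}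
    (hz : z ∈ chamber N) {κ : ℂ} (hκ : (1 / κ).re < 1) :
    cycleIntegral lam κ c z = blockIntegral lam c z κ := by
  rw [cycleIntegral, blockIntegral]
  simp only [integrand_eq lam κ c hz.1]
  rw [integral_const_mul]
  congr 1
  exact integral_modelIntegrand _ _ _ (abs_crossRatio_lt_one c hz) hκ

lemma regularLevels_eq : regularLevels = {κ | κ ≠ 0} ∩ (fun κ => 1 / κ) ⁻¹' regularSet := rfl

lemma isOpen_regularLevels : IsOpen regularLevels := by
  rw [regularLevels_eq]
  refine ContinuousOn.isOpen_inter_preimage ?_ isOpen_ne isOpen_regularSet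
  exact continuousOn_const.div continuousOn_id fun κ hκ => hκ

lemma isPreconnected_regularLevels : IsPreconnected regularLevels := by
  have h : regularLevels = (insert 0 (Set.range fun k : ℕ => 1 / ((k : ℂ) + 1)))ᶜ := by
    ext κ
    simp only [Set.mem_compl_iff, Set.mem_insert_iff, Set.mem_range, not_or, not_exists]
    refine and_congr_right fun hκ => forall_congr' fun k => not_congr ⟨fun h => ?_, fun h => ?_⟩
    · rw [← h, one_div_one_div]
    · rw [← h, one_div_one_div]
  rw [h]
  exact (Set.Countable.isConnected_compl_of_one_lt_rank
    (by rw [rank_real_complex]; exact Cardinal.one_lt_two)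
    ((Set.countable_range _).insert _)).isPreconnected

lemma analyticOnNhd_blockIntegral (lam : Fin (n + 1) → ℂ) (c : Fin N → Fin (n + 1))
    {z : Fin N → ℝ} (hz : z ∈ chamber N) :
    AnalyticOnNhd ℂ (blockIntegral lam c z) regularLevels := by
  refine DifferentiableOn.analyticOnNhd ?_ isOpen_regularLevels
  have hinv : DifferentiableOn ℂ (fun κ : ℂ => 1 / κ) regularLevels := fun κ hκ =>
    ((differentiableAt_const _).div differentiableAt_id hκ.1).differentiableWithinAt
  have h1 : DifferentiableOn ℂ (fun κ => monomial (mu lam κ c) z) regularLevels := by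
    have e : ∀ κ, monomial (mu lam κ c) z =
        exp (∑ j, muNumerator lam c j * (1 / κ) * Real.log (z j)) := by
      intro κ
      rw [monomial_eq_exp _ hz.1]
      congr 1
      refine Finset.sum_congr rfl fun j _ => ?_
      rw [mu, ← muNumerator]
      ring
    simp only [e]
    refine DifferentiableOn.cexp (DifferentiableOn.fun_sum fun j _ => ?_)
    exact (hinv.const_mul _).mul_const _
  exact (h1.mul_const _).mul ((differentiableOn_loopSeries _ _ _ (abs_crossRatio_lt_one c hz)).comp
    hinv fun κ hκ => hκ.2)

theorem isBlockIntegral_blockIntegral (lam : Fin (n + 1) → ℂ) (c : Fin N → Fin (n + 1)) :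
    IsBlockIntegral lam c (blockIntegral lam c) where
  analytic _ hz := analyticOnNhd_blockIntegral lam c hz
  eq_integral _ hz _ _ hκ := (cycleIntegral_eq lam c hz hκ).symm

theorem IsBlockIntegral.eq_blockIntegral {lam : Fin (n + 1) → ℂ} {c : Fin N → Fin (n + 1)}
    {F : (Fin N → ℝ) → ℂ → ℂ} (hF : IsBlockIntegral lam c F) {z : Fin N → ℝ} (hz : z ∈ chamber N)
    {κ : ℂ} (hκ : κ ∈ regularLevels) : F z κ = blockIntegral lam c z κ := by
  have h0 : (-1 : ℂ) ∈ regularLevels := by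
    refine ⟨by norm_num, fun k h => ?_⟩
    have := congrArg re h
    simp only [one_div, inv_neg, inv_one, neg_re, one_re, add_re, natCast_re] at this
    have hk : (0 : ℝ) ≤ k := by positivity
    linarith
  refine (hF.analytic z hz).eqOn_of_preconnected_of_eventuallyEq
    (analyticOnNhd_blockIntegral lam c hz) isPreconnected_regularLevels h0 ?_ hκ
  have h1 : ContinuousAt (fun κ : ℂ => (1 / κ).re) (-1) :=
    continuous_re.continuousAt.comp (f := fun κ : ℂ => 1 / κ)
      (continuousAt_const.div continuousAt_id (by norm_num))
  filter_upwards [h1.eventually (gt_mem_nhds (show (1 / (-1 : ℂ)).re < 1 by norm_num)),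
    isOpen_regularLevels.mem_nhds h0] with κ h2 h3
  rw [hF.eq_integral z hz κ h3.1 h2, cycleIntegral_eq lam c hz h2]

lemma tendsto_ratio {i j : Fin N} (hij : i < j) :
    Tendsto (fun z : Fin N → ℝ => z i / z j) (asymptoticRegime N) (𝓝 0) := by
  refine tendsto_comap.mono_left (inf_le_right.trans ?_)
  exact (iInf_le _ i).trans ((iInf_le _ j).trans (iInf_le _ hij))

lemma tendsto_crossRatio (c : Fin N → Fin (n + 1)) :
    Tendsto (fun z => crossRatio c z) (asymptoticRegime N) (𝓝 0) := by
  refine tendsto_pi_nhds.mpr fun p => ?_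
  rcases p with ⟨j, v⟩ | ⟨v, w⟩ <;> simp only [crossRatio, Pi.zero_apply]
  · split_ifs with h1 h2
    exacts [tendsto_ratio h1, tendsto_ratio h2, tendsto_const_nhds]
  · split_ifs with h1
    exacts [tendsto_ratio h1, tendsto_const_nhds]

lemma leadingCoeff_eq (lam : Fin (n + 1) → ℂ) (κ : ℂ) (c : Fin N → Fin (n + 1)) :
    leadingCoeff lam κ c = I ^ Fintype.card (Var c) *
      ∏ v, loopBeta (1 / κ * loopExponent lam c v) (1 / κ) := by
  have hI : I ^ Fintype.card (Var c) = ∏ _v : Var c, I := by simp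
  rw [hI, ← Finset.prod_mul_distrib, leadingCoeff, Fintype.prod_sigma]
  refine Finset.prod_congr rfl fun j _ => ?_
  have hidx : ∀ f : ℕ → ℂ, ∏ p ∈ Finset.Icc 1 (c j : ℕ), f p =
      ∏ q : Fin (c j : ℕ), f ((c j : ℕ) - q) := by
    intro f
    rw [Fin.prod_univ_eq_prod_range (fun i => f ((c j : ℕ) - i)) (c j : ℕ)]
    refine Finset.prod_nbij' (fun p => (c j : ℕ) - p) (fun i => (c j : ℕ) - i) ?_ ?_ ?_ ?_ ?_
    all_goals
      intro p hp
      simp only [Finset.mem_Icc, Finset.mem_range] at hp ⊢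
    · omega
    · omega
    · omega
    · omega
    · congr 1; omega
  rw [hidx]
  refine Finset.prod_congr rfl fun q _ => ?_
  set A : ℂ := weightBefore lam c j ⬝ᵥ negTail c j ((c j : ℕ) - q) with hA
  have hp : (((c j : ℕ) - (q : ℕ) : ℕ) : ℂ) = ((c j : ℕ) : ℂ) - ((q : ℕ) : ℂ) :=
    Nat.cast_sub q.isLt.le
  have hL : loopExponent lam c ⟨j, q⟩ = A - (((c j : ℕ) : ℂ) - ((q : ℕ) : ℂ)) + 1 := rfl
  rw [hL, loopBeta, dotProduct_neg, ← hA, hp]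
  set P : ℂ := ((c j : ℕ) : ℂ) - ((q : ℕ) : ℂ)
  rw [show A / κ - (P - 1) / κ = 1 / κ * (A - P + 1) by ring,
    show A / κ - P / κ + 1 = 1 / κ * (A - P + 1) - 1 / κ + 1 by ring,
    show -A / κ + (P - 1) / κ + 1 = 1 - 1 / κ * (A - P + 1) by ring]
  ring

theorem tendsto_blockIntegral (lam : Fin (n + 1) → ℂ) (c : Fin N → Fin (n + 1)) {κ : ℂ}
    (hκ : κ ∈ regularLevels) :
    Tendsto (fun z => blockIntegral lam c z κ / monomial (mu lam κ c) z) (asymptoticRegime N)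
      (𝓝 (leadingCoeff lam κ c)) := by
  have h := ((tendsto_loopSeries (loopExponent lam c) (crossExponent c) (crossWinding c)
    (s := 1 / κ) hκ.2).comp (tendsto_crossRatio c)).const_mul (I ^ Fintype.card (Var c))
  rw [← leadingCoeff_eq] at h
  refine h.congr' ?_
  have hch : ∀ᶠ z in asymptoticRegime N, z ∈ chamber N :=
    (mem_inf_of_left (mem_principal_self _))
  filter_upwards [hch] with z hz
  have hne : monomial (mu lam κ c) z ≠ 0 := by
    rw [monomial_eq_exp _ hz.1]; exact exp_ne_zero _
  rw [blockIntegral, mul_assoc, mul_div_cancel_left₀ _ hne]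
  rfl

/-! ### Genericity -/

lemma sum_simpleRoot_Ico {a b : ℕ} (hab : a ≤ b) (hb : b ≤ n) (i : Fin (n + 1)) :
    (∑ m : Fin n with a ≤ m.val ∧ m.val < b, simpleRoot n m) i =
      (if (i : ℕ) = a then 1 else 0) - (if (i : ℕ) = b then 1 else 0) := by
  induction b, hab using Nat.le_induction with
  | base =>
    rw [Finset.filter_false_of_mem fun m _ => by omega]
    simp
  | succ b hab ih =>
    have e : (Finset.univ.filter fun m : Fin n => a ≤ m.val ∧ m.val < b + 1) =
        insert (⟨b, hb⟩ : Fin n) (Finset.univ.filter fun m : Fin n => a ≤ m.val ∧ m.val < b) := by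
      ext m
      simp only [Finset.mem_filter, Finset.mem_univ, true_and, Finset.mem_insert, Fin.ext_iff]
      omega
    rw [e, Finset.sum_insert (by simp), Pi.add_apply, ih (by omega), simpleRoot_apply]
    ring

lemma dotProduct_sum_simpleRoot_Ico (x : Fin (n + 1) → ℂ) {a b : Fin (n + 1)} (hab : a ≤ b) :
    x ⬝ᵥ (∑ m : Fin n with a.val ≤ m.val ∧ m.val < b.val, -simpleRoot n m) = x b - x a := by
  have e : (∑ m : Fin n with a.val ≤ m.val ∧ m.val < b.val, -simpleRoot n m) =
      Pi.single b 1 - Pi.single a 1 := by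
    rw [Finset.sum_neg_distrib]
    ext i
    rw [Pi.neg_apply, sum_simpleRoot_Ico hab (Nat.lt_succ_iff.mp b.isLt)]
    simp only [Pi.sub_apply, Pi.single_apply, Fin.ext_iff]
    ring
  rw [e, dotProduct_sub, dotProduct_single_one, dotProduct_single_one]

lemma h_apply (k i : Fin (n + 1)) :
    h n k i = (if k = i then 1 else 0) - 1 / ((n : ℂ) + 1) := by
  have e := sum_simpleRoot_Ico (n := n) (Nat.zero_le k.val) (Nat.lt_succ_iff.mp k.isLt) i
  simp only [Nat.zero_le, true_and] at e
  rw [h, Pi.sub_apply, e, Lambda1_apply]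
  simp only [Fin.ext_iff, eq_comm (a := (k : ℕ))]
  ring

/-- The number of steps before `j` with label `a`. -/
def labelCount (c : Fin N → Fin (n + 1)) (j : Fin N) (a : Fin (n + 1)) : ℕ :=
  (Finset.univ.filter fun k : Fin N => k < j ∧ c k = a).card

lemma weightBefore_apply (lam : Fin (n + 1) → ℂ) (c : Fin N → Fin (n + 1)) (j : Fin N)
    (i : Fin (n + 1)) :
    weightBefore lam c j i = lam i + labelCount c j i - ((j : ℕ) : ℂ) * (1 / ((n : ℂ) + 1)) := by
  rw [weightBefore, shiftBefore, Pi.add_apply, Finset.sum_apply]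
  simp only [h_apply, Finset.sum_sub_distrib, Finset.sum_const, card_filter_lt, nsmul_eq_mul,
    Finset.sum_boole, labelCount, Finset.filter_filter]
  ring

lemma weightBefore_dotProduct_negTail (lam : Fin (n + 1) → ℂ) (c : Fin N → Fin (n + 1))
    (j : Fin N) {p : ℕ} (hp : p ≤ (c j : ℕ)) :
    ∃ K : ℤ, weightBefore lam c j ⬝ᵥ negTail c j p =
      lam (c j) - lam ⟨(c j : ℕ) - p, by omega⟩ + K := by
  have e : negTail c j p = ∑ m : Fin n with
      (⟨(c j : ℕ) - p, by omega⟩ : Fin (n + 1)).val ≤ m.val ∧ m.val < (c j).val,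
      -simpleRoot n m := by
    refine Finset.sum_congr (Finset.filter_congr fun m _ => ?_) fun _ _ => rfl
    simp only
    omega
  refine ⟨(labelCount c j (c j) : ℤ) - labelCount c j ⟨(c j : ℕ) - p, by omega⟩, ?_⟩
  rw [e, dotProduct_sum_simpleRoot_Ico _ (Fin.le_def.mpr (by simp)), weightBefore_apply,
    weightBefore_apply]
  push_cast
  ring

lemma muNumerator_eq (lam : Fin (n + 1) → ℂ) (c : Fin N → Fin (n + 1)) (j : Fin N) :
    muNumerator lam c j = lam (c j) - lam 0 + labelCount c j (c j) - ((c j : ℕ) : ℂ) -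
      ((j : ℕ) : ℂ) := by
  have e := dotProduct_sum_simpleRoot_Ico (weightBefore lam c j) (Fin.zero_le (c j))
  simp only [Fin.val_zero, Nat.zero_le, true_and] at e
  have hc : (∑ k : Fin N with k < j, if 0 < (c k : ℕ) then (1 : ℂ) else 0) +
      labelCount c j 0 = ((j : ℕ) : ℂ) := by
    have h1 : (labelCount c j 0 : ℂ) =
        ∑ k : Fin N with k < j, if c k = 0 then (1 : ℂ) else 0 := by
      rw [Finset.sum_boole, labelCount, Finset.filter_filter]
    have h2 : ∀ k, (if 0 < (c k : ℕ) then (1 : ℂ) else 0) + (if c k = 0 then (1 : ℂ) else 0) =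
        1 := by
      intro k
      by_cases hk : c k = 0
      · simp [hk]
      · have : 0 < (c k : ℕ) := Nat.pos_of_ne_zero fun h => hk (Fin.ext h)
        simp [hk, this]
    rw [h1, ← Finset.sum_add_distrib]
    simp only [h2, Finset.sum_const, card_filter_lt, nsmul_eq_mul, mul_one]
  rw [muNumerator, e, shiftBefore_sub_dotProduct, weightBefore_apply, weightBefore_apply]
  linear_combination -hc

lemma labelCount_lt {c : Fin N → Fin (n + 1)} {i j : Fin N} (hij : i < j) :
    labelCount c i (c i) < labelCount c j (c i) := by
  refine Finset.card_lt_card ⟨fun k hk => ?_, fun hsub => ?_⟩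
  · simp only [Finset.mem_filter, Finset.mem_univ, true_and] at hk ⊢
    exact ⟨hk.1.trans hij, hk.2⟩
  · have := @hsub i (by simp [hij])
    simp at this

lemma labelCount_le (c : Fin N → Fin (n + 1)) (a : Fin (n + 1)) {i j : Fin N} (hij : i < j) :
    labelCount c j a + (i : ℕ) ≤ labelCount c i a + (j : ℕ) := by
  have hsub : (Finset.univ.filter fun k : Fin N => k < j ∧ c k = a) ⊆
      (Finset.univ.filter fun k : Fin N => k < i ∧ c k = a) ∪ Finset.Ico i j := by
    intro k hk
    simp only [Finset.mem_filter, Finset.mem_univ, true_and, Finset.mem_union,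
      Finset.mem_Ico] at hk ⊢
    rcases lt_or_ge k i with h | h
    · exact Or.inl ⟨h, hk.2⟩
    · exact Or.inr ⟨h, hk.1⟩
  have h1 := (Finset.card_le_card hsub).trans (Finset.card_union_le _ _)
  rw [Fin.card_Ico] at h1
  have h2 : (i : ℕ) < j := hij
  unfold labelCount
  omega

namespace IsGeneric

variable {lam : Fin (n + 1) → ℂ} {κ : ℂ}

lemma mem_regularLevels (hg : IsGeneric lam κ) : κ ∈ regularLevels := by
  have h0 : κ ≠ 0 := by simpa using hg.1 0
  refine ⟨h0, fun k hk => hg.1 (1 / ((k : ℚ) + 1)) ?_⟩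
  push_cast
  rw [← hk, one_div_one_div]

lemma intCast_div_ne (hg : IsGeneric lam κ) {K : ℤ} (hK : K ≠ 0) (m : ℤ) : (K : ℂ) / κ ≠ m := by
  intro h
  have h0 := hg.mem_regularLevels.1
  have hm : (m : ℂ) ≠ 0 := by
    rw [← h]; exact div_ne_zero (by exact_mod_cast hK) h0
  refine hg.1 ((K : ℚ) / m) ?_
  push_cast
  rw [eq_div_iff hm]
  rw [div_eq_iff h0] at h
  rw [h]; ring

lemma sub_add_div_ne (hg : IsGeneric lam κ) {a b : Fin (n + 1)} (hab : a ≠ b) (K m : ℤ) :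
    (lam a - lam b + K) / κ ≠ m := by
  intro h
  rw [div_eq_iff hg.mem_regularLevels.1] at h
  refine hg.2 a b hab (-K) m ?_
  push_cast
  linear_combination h

lemma leadingCoeff_ne_zero (hg : IsGeneric lam κ) (c : Fin N → Fin (n + 1)) :
    leadingCoeff lam κ c ≠ 0 := by
  have h0 := hg.mem_regularLevels.1
  refine Finset.prod_ne_zero_iff.mpr fun j _ => Finset.prod_ne_zero_iff.mpr fun p hp => ?_
  rw [Finset.mem_Icc] at hp
  obtain ⟨K, hK⟩ := weightBefore_dotProduct_negTail lam c j hp.2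
  have hne : c j ≠ ⟨(c j : ℕ) - p, by omega⟩ := by
    intro h
    have := congrArg Fin.val h
    simp only at this
    omega
  refine mul_ne_zero (exp_ne_zero _) (div_ne_zero (mul_ne_zero ?_ ?_) (mul_ne_zero ?_ ?_))
  · refine Gamma_ne_zero fun m hm => hg.mem_regularLevels.2 m ?_
    linear_combination -hm
  · have := Real.pi_ne_zero
    simp [this]
  · refine Gamma_ne_zero fun m hm => hg.sub_add_div_ne hne (K - p) (-m - 1) ?_
    rw [hK] at hm
    push_cast
    linear_combination hm
  · refine Gamma_ne_zero fun m hm => hg.sub_add_div_ne hne (K - p + 1) (m + 1) ?_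
    rw [dotProduct_neg, hK] at hm
    push_cast
    linear_combination -hm

/-- Two steps with different labels are separated by `λ`. For two steps with the same label only
an integer is left. It is not `0`, since `labelCount` of that label grows strictly from one step to
the other, but not faster than the number of steps. -/
lemma mu_sub_mu_ne (hg : IsGeneric lam κ) (c : Fin N → Fin (n + 1)) {i j : Fin N} (hij : i ≠ j)
    {d : ℤ} (hd : d = (j : ℤ) - (i : ℤ) ∨ d = (i : ℤ) - (j : ℤ)) (m : ℤ) :
    mu lam κ c i - mu lam κ c j + (d : ℂ) / κ ≠ m := by
  have e : mu lam κ c i - mu lam κ c j + (d : ℂ) / κ = (lam (c i) - lam (c j) +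
      (((labelCount c i (c i) : ℤ) - (c i : ℕ) - (i : ℕ) - ((labelCount c j (c j) : ℤ) -
        (c j : ℕ) - (j : ℕ)) + d : ℤ) : ℂ)) / κ := by
    rw [mu, mu, ← muNumerator, ← muNumerator, muNumerator_eq, muNumerator_eq]
    push_cast
    ring
  rw [e]
  by_cases hc : c i = c j
  · rw [hc, sub_self, zero_add]
    refine hg.intCast_div_ne ?_ m
    rcases lt_or_gt_of_ne hij with h | h
    · have h1 := labelCount_lt (c := c) h
      have h2 := labelCount_le c (c i) h
      have h3 : (i : ℕ) < j := h
      rw [hc] at h1 h2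
      rcases hd with rfl | rfl <;> omega
    · have h1 := labelCount_lt (c := c) h
      have h2 := labelCount_le c (c j) h
      have h3 : (j : ℕ) < i := h
      rcases hd with rfl | rfl <;> omega
  · exact hg.sub_add_div_ne hc _ m

end IsGeneric

end SelbergBlock

theorem proposition1 (n N : ℕ) (c : Fin N → Fin (n + 1)) (lam : Fin (n + 1) → ℂ)
    (hlam : lam ∈ Submodule.span ℂ (Set.range (SelbergBlock.simpleRoot n))) :
    -- the integral converges absolutely for `Re (1/κ) < 1`
    (∀ z ∈ SelbergBlock.chamber N, ∀ κ : ℂ, κ ≠ 0 → (1 / κ).re < 1 →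
      IntegrableOn (SelbergBlock.integrand lam κ c z) (SelbergBlock.cube c)) ∧
    -- it continues analytically to all regular `κ`
    (∃ F : (Fin N → ℝ) → ℂ → ℂ, SelbergBlock.IsBlockIntegral lam c F) ∧
    -- its leading asymptotic
    (∀ F : (Fin N → ℝ) → ℂ → ℂ, SelbergBlock.IsBlockIntegral lam c F →
      ∀ κ ∈ SelbergBlock.regularLevels,
        Tendsto (fun z => F z κ / SelbergBlock.monomial (SelbergBlock.mu lam κ c) z)
          (SelbergBlock.asymptoticRegime N) (𝓝 (SelbergBlock.leadingCoeff lam κ c))) ∧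
    -- for generic `λ` and `κ`
    (∀ κ : ℂ, SelbergBlock.IsGeneric lam κ →
      κ ∈ SelbergBlock.regularLevels ∧
      SelbergBlock.leadingCoeff lam κ c ≠ 0 ∧
      ∀ i j : Fin N, i ≠ j → ∀ m : ℤ,
        SelbergBlock.mu lam κ c i - SelbergBlock.mu lam κ c j
          + 1 / κ * (((j : ℕ) : ℂ) - ((i : ℕ) : ℂ)) ≠ (m : ℂ) ∧
        (SelbergBlock.mu lam κ c i - SelbergBlock.rho N κ i)
          - (SelbergBlock.mu lam κ c j - SelbergBlock.rho N κ j) ≠ (m : ℂ)) := by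
  refine ⟨fun z hz κ _ hκ => SelbergBlock.integrableOn_integrand lam c hz hκ,
    ⟨_, SelbergBlock.isBlockIntegral_blockIntegral lam c⟩, fun F hF κ hκ => ?_,
    fun κ hg => ⟨hg.mem_regularLevels, hg.leadingCoeff_ne_zero c, fun i j hij m => ⟨?_, ?_⟩⟩⟩
  · refine (SelbergBlock.tendsto_blockIntegral lam c hκ).congr' ?_
    have hch : ∀ᶠ z in SelbergBlock.asymptoticRegime N, z ∈ SelbergBlock.chamber N :=
      mem_inf_of_left (mem_principal_self _)
    filter_upwards [hch] with z hz
    rw [hF.eq_blockIntegral hz hκ]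
  · intro h
    refine hg.mu_sub_mu_ne c hij (Or.inl rfl) m ?_
    rw [← h]
    push_cast
    ring
  · intro h
    refine hg.mu_sub_mu_ne c hij (Or.inr rfl) m ?_
    rw [← h, SelbergBlock.rho, SelbergBlock.rho]
    push_cast
    have := hg.mem_regularLevels.1
    field_simp
    ring
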